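/- Let $(\Omega,\mu)$ be a probability space and let $T_t=e^{-At}:L_\infty(\Omega,\mu)\to L_\infty(\Omega,\mu)$, $t\ge 0$, be a symmetric Markov semigroup: each $T_t$ is a normal, positive, unital linear map that is self-adjoint for the inner product of $L_2(\mu)$, $T_0=\mathrm{id}$, $T_{s+t}=T_sT_t$, and $t\mapsto T_tf$ is ultraweakly continuous for every $f$. Let $Af=\lim_{t\downarrow 0}\frac1t(f-T_tf)$ (limit in $L_2$) be its positive generator, and let $\mathcal A=\operatorname{dom}(A^{1/2})\cap L_\infty$ be its Dirichlet algebra. Suppose that * $T_t$ is ergodic: the only $f\in L_\infty$ with $T_tf=f$ for all $t\geq 0$ are the constants; * $T_t$ is a diffusion: for $f,g\in\mathcal A$ the gradient form $\Gamma(f,g)=\frac12\big((Af)g+f(Ag)-A(fg)\big)$ exists as an element of $L_1(\mu)$ (as the $L_1$-limit, for $t\downarrow0$, of the same expression with $A$ replaced by $\frac1t(\mathrm{id}-T_t)$), and $\Gamma(fh,g)=f\,\Gamma(h,g)+h\,\Gamma(f,g)$ for all $f,g,h\in\mathcal A$; * $T_t$ satisfies $CD(\lambda,\infty)$ for some $\lambda\in\mathbb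 R$: $\Gamma_2(f)\ge\lambda\,\Gamma(f,f)$, where $\Gamma_2(f)=\frac12\big(\Gamma(Af,f)+\Gamma(f,Af)-A\Gamma(f,f)\big)$, in the weak sense that $$\frac12\Big(\int\varphi\,\Gamma(Af,f)\,d\mu+\int\varphi\,\Gamma(f,Af)\,d\mu-\int (A\varphi)\,\Gamma(f,f)\,d\mu\Big)\ \ge\ \lambda\int\varphi\,\Gamma(f,f)\,d\mu$$ for all $f\in\operatorname{dom}(A)\cap L_\infty$ with $Af\in\mathcal A$ and all $0\le\varphi\in\operatorname{dom}(A)\cap L_\infty$ with $A\varphi\in L_\infty$; * for some $c,d>0$, $\|T_t:L_1(\Omega)\to L_\infty(\Omega)\|\le c\,t^{-d/2}$ for all $0<t<1$; * $A$ has spectral gap $\sigma>0$: $\|f-\int f\,d\mu\|_2\le\sigma^{-1}\|Af\|_2$ for all $f\in\operatorname{dom}(A)$. Then $T_t$ satisfies the $m(\lambda)$-modified logarithmic Sobolev inequality with $$m(\lambda)=\begin{cases}\Big(2+\frac{2(d+2)}{\sigma}\log 2+\frac4\sigma\log c\Big)^{-1},&\lambda=0,\\[4pt] \lambda\Big(2-e^{-\lambda}\,2^{\,1-(d+2)\lambda/\sigma}\,c^{-2\lambda/\sigma}\Big)^{-1},&\lambda\ne0,\end{cases}$$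 that is, $m(\lambda)>0$ and $$2\,m(\lambda)\int\rho\log\rho\,d\mu\ \le\ \int (A\rho)\log\rho\,d\mu$$ for every probability density $\rho\in\operatorname{dom}(A)$ with $a\le\rho\le b$ almost everywhere for some constants $a,b>0$. -/

import Mathlib

open MeasureTheory Filter Topology
open scoped ENNReal

noncomputable section

namespace DiffusionMLSI

variable {Ω : Type*} [MeasurableSpace Ω] {μ : Measure Ω}

/-- The real algebra `L_∞(Ω, μ)`. -/
abbrev Linf (μ : Measure Ω) : Type _ := Lp ℝ ∞ μ

/-- The pointwise product of two bounded functions, as an element of `L_∞(Ω, μ)`. -/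
def mulLinf (f g : Linf μ) : Linf μ :=
  MemLp.toLp (fun x => f x * g x) ((Lp.memLp g).mul' (Lp.memLp f))

/-- A Markov semigroup `(T_t)_{t ≥ 0}` on `L_∞(Ω, μ)`; only the values at times `t ≥ 0` matter.
On a commutative algebra complete positivity is positivity. A map of `L_∞` is normal if and only
if it has a pre-adjoint on `L_1`, which is what `normal` says. The ultraweak topology of `L_∞` is
given by the pairings with integrable functions. -/
structure IsMarkovSemigroup [IsFiniteMeasure μ] (T : ℝ → Linf μ →L[ℝ] Linf μ) : Prop where
  nonneg : ∀ t, 0 ≤ t → ∀ f : Linf μ, 0 ≤ f → 0 ≤ T t f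
  unital : ∀ t, 0 ≤ t → T t (Lp.const ∞ μ (1 : ℝ)) = Lp.const ∞ μ (1 : ℝ)
  normal : ∀ t, 0 ≤ t → ∀ g : Ω → ℝ, Integrable g μ → ∃ h : Ω → ℝ, Integrable h μ ∧
    ∀ f : Linf μ, ∫ x, g x * T t f x ∂μ = ∫ x, h x * f x ∂μ
  zero : T 0 = ContinuousLinearMap.id ℝ (Linf μ)
  add : ∀ s t, 0 ≤ s → 0 ≤ t → T (s + t) = (T s).comp (T t)
  ultraweak_continuous : ∀ f : Linf μ, ∀ g : Ω → ℝ, Integrable g μ →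
    ContinuousOn (fun t => ∫ x, g x * T t f x ∂μ) (Set.Ici 0)

/-- Every `T_t` is self-adjoint for the inner product of `L_2(Ω, μ)`. -/
def IsSymmetricSemigroup (T : ℝ → Linf μ →L[ℝ] Linf μ) : Prop :=
  ∀ t, 0 ≤ t → ∀ f g : Linf μ, ∫ x, f x * T t g x ∂μ = ∫ x, T t f x * g x ∂μ

/-- The fixed-point algebra consists of the constants. -/
def IsErgodicSemigroup [IsFiniteMeasure μ] (T : ℝ → Linf μ →L[ℝ] Linf μ) : Prop :=
  ∀ f : Linf μ, (∀ t, 0 ≤ t → T t f = f) → ∃ a : ℝ, f = Lp.const ∞ μ a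

/-- `HasGenerator T f g`: the bounded function `f` is in the domain of the (positive) generator `A`
of the semigroup on `L_2(Ω, μ)`, and `A f = g`, i.e. `(f - T_t f) / t → g` in `L_2` as `t ↓ 0`.
Bounded functions form a core of the generator. -/
def HasGenerator (T : ℝ → Linf μ →L[ℝ] Linf μ) (f : Linf μ) (g : Ω → ℝ) : Prop :=
  MemLp g 2 μ ∧
    Tendsto (fun t : ℝ => eLpNorm (fun x => (f x - T t f x) / t - g x) 2 μ) (𝓝[>] 0) (𝓝 0)

/-- `f` lies in the Dirichlet algebra `dom(A^{1/2}) ∩ L_∞`: the approximating Dirichlet forms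
`⟨f, f - T_t f⟩ / t`, which increase to `𝓔(f, f)` as `t ↓ 0`, stay bounded. -/
def InDirichletAlgebra (T : ℝ → Linf μ →L[ℝ] Linf μ) (f : Linf μ) : Prop :=
  ∃ C : ℝ, ∀ t : ℝ, 0 < t → (∫ x, f x * (f x - T t f x) ∂μ) / t ≤ C

/-- The gradient form `((A_t f) g + f (A_t g) - A_t (f g)) / 2` of `A_t = (id - T_t) / t`. -/
def approxGamma (T : ℝ → Linf μ →L[ℝ] Linf μ) (t : ℝ) (f g : Linf μ) (x : Ω) : ℝ :=
  ((f x - T t f x) / t * g x + f x * ((g x - T t g x) / t)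
    - (mulLinf f g x - T t (mulLinf f g) x) / t) / 2

/-- `HasGamma T f g γ`: the gradient form (carré du champ)
`Γ(f, g) = ((A f) g + f (A g) - A (f g)) / 2` exists in `L_1(Ω, μ)` and equals `γ`; it is the
`L_1`-limit of the gradient forms of `A_t = (id - T_t) / t` as `t ↓ 0`. -/
def HasGamma (T : ℝ → Linf μ →L[ℝ] Linf μ) (f g : Linf μ) (γ : Ω → ℝ) : Prop :=
  Integrable γ μ ∧
    Tendsto (fun t : ℝ => eLpNorm (fun x => approxGamma T t f g x - γ x) 1 μ) (𝓝[>] 0) (𝓝 0)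

/-- The diffusion property: the gradient form exists on the Dirichlet algebra and satisfies
`Γ(f h, g) = f Γ(h, g) + h Γ(f, g)`. -/
structure IsDiffusion (T : ℝ → Linf μ →L[ℝ] Linf μ) : Prop where
  exists_gamma : ∀ f g : Linf μ, InDirichletAlgebra T f → InDirichletAlgebra T g →
    ∃ γ : Ω → ℝ, HasGamma T f g γ
  product_rule : ∀ f h g : Linf μ, InDirichletAlgebra T f → InDirichletAlgebra T h →
    InDirichletAlgebra T g → ∀ γhg γfg : Ω → ℝ, HasGamma T h g γhg → HasGamma T f g γfg →
      HasGamma T (mulLinf f h) g (fun x => f x * γhg x + h x * γfg x)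

/-- The curvature-dimension condition `CD(lam, ∞)`, i.e. `Γ₂(f) ≥ lam Γ(f)` with
`Γ₂(f) = (Γ(A f, f) + Γ(f, A f) - A Γ(f, f)) / 2`. As `Γ(f, f)` is in general only an `L_1`
function, the inequality is tested against bounded `φ ≥ 0` with `A φ` bounded, and `A` is moved
to `φ` by symmetry; `f` runs over the bounded functions in the domain of `A` for which `A f` is
in the Dirichlet algebra, so that `Γ(A f, f)` is defined. -/
def CurvatureDimension (T : ℝ → Linf μ →L[ℝ] Linf μ) (lam : ℝ) : Prop :=
  ∀ f Af : Linf μ, HasGenerator T f Af → InDirichletAlgebra T Af →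
    ∀ γ γ₁ γ₂ : Ω → ℝ, HasGamma T f f γ → HasGamma T Af f γ₁ → HasGamma T f Af γ₂ →
      ∀ φ Aφ : Linf μ, 0 ≤ φ → HasGenerator T φ Aφ →
        lam * ∫ x, φ x * γ x ∂μ ≤
          (∫ x, φ x * γ₁ x ∂μ + ∫ x, φ x * γ₂ x ∂μ - ∫ x, Aφ x * γ x ∂μ) / 2

/-- `‖T_t : L_1 → L_∞‖ ≤ c t^{-d/2}` for `0 < t < 1` (it suffices to test on the dense subspace
`L_∞` of `L_1`). -/
def VaropoulosBound (T : ℝ → Linf μ →L[ℝ] Linf μ) (c d : ℝ) : Prop :=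
  ∀ t : ℝ, 0 < t → t < 1 → ∀ f : Linf μ, ‖T t f‖ ≤ c * t ^ (-(d / 2)) * ∫ x, |f x| ∂μ

/-- Spectral gap `σ`: `‖A⁻¹ (id - E) : L_2 → L_2‖ ≤ σ⁻¹` with `E f = ∫ f`, that is
`‖f - E f‖₂ ≤ σ⁻¹ ‖A f‖₂` on the domain of `A` (tested on its core of bounded functions). -/
def HasSpectralGap (T : ℝ → Linf μ →L[ℝ] Linf μ) (σ : ℝ) : Prop :=
  ∀ (f : Linf μ) (g : Ω → ℝ), HasGenerator T f g →
    eLpNorm (fun x => f x - ∫ y, f y ∂μ) 2 μ ≤ ENNReal.ofReal σ⁻¹ * eLpNorm g 2 μ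

/-- The `m`-modified logarithmic Sobolev inequality of an ergodic semigroup: `m > 0` and
`2 m D(ρ ‖ 1) ≤ I(ρ) = ∫ (A ρ) log ρ` for every probability density `ρ` in the domain of `A` that
is bounded and bounded away from zero. -/
def SatisfiesMLSI (T : ℝ → Linf μ →L[ℝ] Linf μ) (m : ℝ) : Prop :=
  0 < m ∧ ∀ (ρ : Linf μ) (Aρ : Ω → ℝ), (∃ a : ℝ, 0 < a ∧ ∀ᵐ x ∂μ, a ≤ ρ x) →
    ∫ x, ρ x ∂μ = 1 → HasGenerator T ρ Aρ →
      2 * m * ∫ x, ρ x * Real.log (ρ x) ∂μ ≤ ∫ x, Aρ x * Real.log (ρ x) ∂μ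

/-- The explicit constant `m(lam)`. -/
def mlsiConstant (c d σ lam : ℝ) : ℝ :=
  if lam = 0 then
    (2 + 2 * (d + 2) / σ * Real.log 2 + 4 / σ * Real.log c)⁻¹
  else
    lam * (2 - Real.exp (-lam) * 2 ^ (1 - (d + 2) * lam / σ) * c ^ (-(2 * lam / σ)))⁻¹

end DiffusionMLSI

end

/-!
`CD(λ, ∞)` makes the Fisher information `I(ρ) = ∫ (A ρ) log ρ = ∫ ρ Γ(log ρ)` decay along the
semigroup, `I(T_t ρ) ≤ e^{-2λt} I(ρ)`, through the gradient estimate `Γ(T_t f) ≤ e^{-2λt} T_t Γ(f)`.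
As `I` is minus the time derivative of the entropy `D`, integrating gives
`D(ρ) - D(T_t ρ) ≤ κ(t) I(ρ)` with `κ(t) = ∫₀ᵗ e^{-2λs} ds`. On the other hand ultracontractivity at
time `1/2` and the spectral gap yield a time `t` with `T_t f ≥ (∫ f) / 2` for all `f ≥ 0`; then
`T_t ρ` is the midpoint of `1` and of the image of `ρ` under a positive unital map preserving `μ`,
so `D(T_t ρ) ≤ D(ρ) / 2` by convexity. Hence `D(ρ) ≤ 2 κ(t) I(ρ)`, and `m(λ) = 1 / (4 κ(t))`.

Ultracontractivity also supplies the regularity needed to differentiate `Γ` along the semigroup: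
for `t > 0` the orbit `t ↦ T_t f` is differentiable in the norm of `L_∞`.
-/

noncomputable section

namespace DiffusionMLSI

section RealCalculus

lemma tendsto_sub_nhdsGT (x : ℝ) : Tendsto (fun y : ℝ => y - x) (𝓝[>] x) (𝓝[>] 0) := by
  refine tendsto_nhdsWithin_iff.2 ⟨?_, ?_⟩
  · simpa using ((continuous_sub_right x).tendsto x).mono_left
      (nhdsWithin_le_nhds (s := Set.Ioi x))
  · filter_upwards [self_mem_nhdsWithin] with y hy using Set.mem_Ioi.2 (sub_pos.2 hy)

lemma antitoneOn_exp_mul {D : Set ℝ} (hD : Convex ℝ D) {f f' : ℝ → ℝ} {a : ℝ}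
    (hf : ContinuousOn f D) (hf' : ∀ x ∈ interior D, HasDerivAt f (f' x) x)
    (hle : ∀ x ∈ interior D, f' x ≤ -(a * f x)) :
    AntitoneOn (fun x => Real.exp (a * x) * f x) D := by
  have hderiv : ∀ x ∈ interior D, HasDerivAt (fun x => Real.exp (a * x) * f x)
      (Real.exp (a * x) * a * f x + Real.exp (a * x) * f' x) x := fun x hx =>
    (by simpa using (hasDerivAt_id x).const_mul a : HasDerivAt (a * ·) a x).exp.mul (hf' x hx)
  refine antitoneOn_of_hasDerivWithinAt_nonpos hD
    (by fun_prop) (fun x hx => (hderiv x hx).hasDerivWithinAt) fun x hx => ?_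
  rw [mul_assoc, ← mul_add]
  exact mul_nonpos_of_nonneg_of_nonpos (Real.exp_pos _).le (by linarith [hle x hx])

lemma mul_le_sub_of_antitoneOn_deriv {F f : ℝ → ℝ} {a b : ℝ} (hab : a < b)
    (hF : ContinuousOn F (Set.Icc a b)) (hF' : ∀ x ∈ Set.Ioo a b, HasDerivAt F (-f x) x)
    (hf : AntitoneOn f (Set.Ioc a b)) : (b - a) * f b ≤ F a - F b := by
  obtain ⟨x, hx, hslope⟩ := exists_hasDerivAt_eq_slope F (fun x => -f x) hab hF hF'
  rw [eq_div_iff (sub_pos.2 hab).ne'] at hslope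
  have := hf ⟨hx.1, hx.2.le⟩ (Set.right_mem_Ioc.2 hab) hx.2.le
  nlinarith [sub_pos.2 hab]

lemma sq_mul_le_of_antitoneOn_deriv_deriv {k p q : ℝ → ℝ} (hk : ContinuousOn k (Set.Ici 0))
    (hkp : ∀ s, 0 < s → HasDerivAt k (-p s) s) (hpq : ∀ s, 0 < s → HasDerivAt p (-q s) s)
    (hk0 : ∀ s, 0 < s → 0 ≤ k s) (hp0 : ∀ s, 0 < s → 0 ≤ p s) (hq0 : ∀ s, 0 < s → 0 ≤ q s)
    (hq : AntitoneOn q (Set.Ioi 0)) {t : ℝ} (ht : 0 < t) : t ^ 2 * q (2 * t) ≤ k 0 := by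
  have hpc : ContinuousOn p (Set.Ioi 0) :=
    fun s hs => (hpq s hs).continuousAt.continuousWithinAt
  have hpa : AntitoneOn p (Set.Ioi 0) := by
    refine antitoneOn_of_hasDerivWithinAt_nonpos (f' := fun s => -q s) (convex_Ioi 0) hpc ?_ ?_
    all_goals rw [interior_Ioi]; intro s hs
    · exact (hpq s hs).hasDerivWithinAt
    · exact neg_nonpos.2 (hq0 s hs)
  have hstep₁ := mul_le_sub_of_antitoneOn_deriv ht (hk.mono Set.Icc_subset_Ici_self)
    (fun s hs => hkp s hs.1) (hpa.mono fun s hs => hs.1)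
  have hstep₂ := mul_le_sub_of_antitoneOn_deriv (F := p) (f := q) (b := 2 * t)
    (by linarith : t < 2 * t) (hpc.mono fun s hs => ht.trans_le hs.1)
    (fun s hs => hpq s (ht.trans hs.1)) (hq.mono fun s hs => ht.trans hs.1)
  nlinarith [hk0 t ht, hp0 (2 * t) (by positivity)]

lemma le_exp_mul_of_sq_mul_le_deriv_deriv {k p q : ℝ → ℝ} {σ C : ℝ} (hσ : 0 < σ)
    (hk : ContinuousOn k (Set.Ici 0)) (hkp : ∀ s, 0 < s → HasDerivAt k (-p s) s)
    (hpq : ∀ s, 0 < s → HasDerivAt p (-q s) s) (hkC : ∀ s, 0 < s → k s ≤ C)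
    (hp0 : ∀ s, 0 < s → 0 ≤ p s) (hq : ∀ s, 0 < s → σ ^ 2 * k s ≤ q s) {t : ℝ} (ht : 0 ≤ t) :
    k t ≤ Real.exp (-(σ * t)) * k 0 := by
  have hanti : AntitoneOn (fun s => Real.exp (-σ * s) * (p s - σ * k s)) (Set.Ioi 0) := by
    have hderiv : ∀ s, 0 < s → HasDerivAt (fun s => p s - σ * k s) (-q s - σ * (-p s)) s :=
      fun s hs => (hpq s hs).sub ((hkp s hs).const_mul σ)
    refine antitoneOn_exp_mul (f' := fun s => -q s - σ * (-p s)) (convex_Ioi 0)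
      (fun s hs => (hderiv s hs).continuousAt.continuousWithinAt) ?_ ?_
    all_goals rw [interior_Ioi]; intro s hs
    · exact hderiv s hs
    · linarith [hq s hs]
  have hlim : Tendsto (fun s => Real.exp (-σ * s) * (-(σ * C))) atTop (𝓝 0) := by
    have hexp : Tendsto (fun s => Real.exp (-σ * s)) atTop (𝓝 0) :=
      Real.tendsto_exp_atBot.comp (tendsto_id.const_mul_atTop_of_neg (neg_neg_of_pos hσ))
    simpa using hexp.mul_const (-(σ * C))
  have hkp_le : ∀ s, 0 < s → σ * k s ≤ p s := by
    intro s hs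
    refine sub_nonneg.1 ((mul_nonneg_iff_of_pos_left (Real.exp_pos (-σ * s))).1 ?_)
    refine le_of_tendsto hlim ?_
    filter_upwards [eventually_ge_atTop s] with x hx
    have hx0 := hs.trans_le hx
    refine (mul_le_mul_of_nonneg_left ?_ (Real.exp_pos _).le).trans (hanti hs hx0 hx)
    nlinarith [hkC x hx0, hp0 x hx0]
  have hdecay : AntitoneOn (fun s => Real.exp (σ * s) * k s) (Set.Ici 0) := by
    refine antitoneOn_exp_mul (f' := fun s => -p s) (convex_Ici 0) hk ?_ ?_
    all_goals rw [interior_Ici]; intro s hs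
    · exact hkp s hs
    · exact neg_le_neg (hkp_le s hs)
  have hle := hdecay Set.self_mem_Ici (Set.mem_Ici.2 ht) ht
  rw [Real.exp_neg, inv_mul_eq_div, le_div_iff₀ (Real.exp_pos _)]
  simpa [mul_comm] using hle

end RealCalculus

section HilbertSemigroup

variable {H : Type*} [NormedAddCommGroup H] [InnerProductSpace ℝ H]

lemma continuous_of_continuous_inner {X : Type*} [TopologicalSpace X] {u : X → H}
    (hself : Continuous fun s => inner ℝ (u s) (u s))
    (h : ∀ t, Continuous fun s => inner ℝ (u s) (u t)) : Continuous u := by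
  refine continuous_iff_continuousAt.2 fun t => tendsto_iff_norm_sub_tendsto_zero.2 ?_
  have hsq : Tendsto (fun s => ‖u s - u t‖ ^ 2) (𝓝 t) (𝓝 0) := by
    have hlim := ((hself.tendsto t).sub (((h t).tendsto t).const_mul 2)).add_const
      (inner ℝ (u t) (u t))
    convert hlim using 2 with s
    · rw [norm_sub_sq_real, ← real_inner_self_eq_norm_sq, ← real_inner_self_eq_norm_sq]
    · ring
  simpa [Real.sqrt_sq (norm_nonneg _)] using hsq.sqrt

/-- A strongly continuous semigroup of symmetric contractions of a real Hilbert space. Times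
`t < 0` are junk, but are required to respect `symm`, `contr` and `cont` (extend the semigroup by
the identity), which saves side conditions. -/
structure IsSymmContractionSemigroup (S : ℝ → H →L[ℝ] H) : Prop where
  zero : ∀ f, S 0 f = f
  add : ∀ s t, 0 ≤ s → 0 ≤ t → ∀ f, S (s + t) f = S s (S t f)
  symm : ∀ t f g, inner ℝ (S t f) g = inner ℝ f (S t g)
  contr : ∀ t f, ‖S t f‖ ≤ ‖f‖
  cont : ∀ f, Continuous fun t => S t f

/-- `HasHilbertGenerator S f g`: the vector `f` is in the domain of the positive generator
`A = lim_{t ↓ 0} (id - S_t) / t` of the semigroup `S`, and `A f = g`. -/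
def HasHilbertGenerator (S : ℝ → H →L[ℝ] H) (f g : H) : Prop :=
  Tendsto (fun t : ℝ => t⁻¹ • (f - S t f)) (𝓝[>] 0) (𝓝 g)

lemma HasHilbertGenerator.sub {S : ℝ → H →L[ℝ] H} {f₁ f₂ g₁ g₂ : H}
    (h₁ : HasHilbertGenerator S f₁ g₁) (h₂ : HasHilbertGenerator S f₂ g₂) :
    HasHilbertGenerator S (f₁ - f₂) (g₁ - g₂) := by
  refine (Tendsto.sub h₁ h₂).congr fun t => ?_
  rw [← smul_sub, map_sub, sub_sub_sub_comm]

lemma HasHilbertGenerator.smul {S : ℝ → H →L[ℝ] H} {f g : H} (h : HasHilbertGenerator S f g)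
    (a : ℝ) : HasHilbertGenerator S (a • f) (a • g) := by
  refine (Tendsto.const_smul h a).congr fun t => ?_
  rw [map_smul, ← smul_sub, smul_comm]

namespace IsSymmContractionSemigroup

variable {S : ℝ → H →L[ℝ] H}

lemma comm (hS : IsSymmContractionSemigroup S) {s t : ℝ} (hs : 0 ≤ s) (ht : 0 ≤ t) (f : H) :
    S s (S t f) = S t (S s f) := by
  rw [← hS.add s t hs ht, ← hS.add t s ht hs, add_comm]

lemma inner_map_eq (hS : IsSymmContractionSemigroup S) {t : ℝ} (ht : 0 ≤ t) (f g : H) :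
    inner ℝ (S t f) g = inner ℝ (S (t / 2) f) (S (t / 2) g) := by
  rw [← hS.symm, ← hS.add _ _ (by positivity) (by positivity), add_halves]

lemma inner_map_self (hS : IsSymmContractionSemigroup S) {t : ℝ} (ht : 0 ≤ t) (f : H) :
    inner ℝ (S t f) f = ‖S (t / 2) f‖ ^ 2 := by
  rw [hS.inner_map_eq ht, real_inner_self_eq_norm_sq]

lemma inner_map_self_nonneg (hS : IsSymmContractionSemigroup S) {t : ℝ} (ht : 0 ≤ t) (f : H) :
    0 ≤ inner ℝ (S t f) f := by
  rw [hS.inner_map_self ht]; positivity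

lemma antitoneOn_inner_map_self (hS : IsSymmContractionSemigroup S) (f : H) :
    AntitoneOn (fun t => inner ℝ (S t f) f) (Set.Ici 0) := by
  intro s hs t ht hst
  have hs' : 0 ≤ s := hs
  have hsplit : S (t / 2) f = S ((t - s) / 2) (S (s / 2) f) := by
    rw [← hS.add _ _ (by linarith) (by linarith)]; congr 2; ring
  simp only [hS.inner_map_self hs, hS.inner_map_self ht, hsplit]
  gcongr
  exact hS.contr _ _

lemma hasHilbertGenerator_map (hS : IsSymmContractionSemigroup S) {f g : H}
    (h : HasHilbertGenerator S f g) {t : ℝ} (ht : 0 ≤ t) :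
    HasHilbertGenerator S (S t f) (S t g) := by
  refine (((S t).continuous.tendsto g).comp h).congr' ?_
  filter_upwards [self_mem_nhdsWithin] with s hs
  rw [Function.comp_apply, map_smul, map_sub, hS.comm ht (le_of_lt hs)]

lemma inner_generator_nonneg (hS : IsSymmContractionSemigroup S) {f g : H}
    (h : HasHilbertGenerator S f g) : 0 ≤ inner ℝ g f := by
  refine ge_of_tendsto (Tendsto.inner (𝕜 := ℝ) h (tendsto_const_nhds (x := f))) ?_
  filter_upwards [self_mem_nhdsWithin] with s hs
  have hle : inner ℝ (S s f) f ≤ inner ℝ f f := calc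
    inner ℝ (S s f) f ≤ ‖S s f‖ * ‖f‖ := real_inner_le_norm _ _
    _ ≤ ‖f‖ * ‖f‖ := by gcongr; exact hS.contr s f
    _ = inner ℝ f f := (real_inner_self_eq_norm_mul_norm f).symm
  rw [real_inner_smul_left, inner_sub_left]
  exact mul_nonneg (inv_nonneg.2 (le_of_lt hs)) (sub_nonneg.2 hle)

lemma hasDerivWithinAt_orbit (hS : IsSymmContractionSemigroup S) {f g : H}
    (h : HasHilbertGenerator S f g) {x : ℝ} (hx : 0 ≤ x) :
    HasDerivWithinAt (fun t => S t f) (-(S x g)) (Set.Ici x) x := by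
  rw [← hasDerivWithinAt_Ioi_iff_Ici, hasDerivWithinAt_iff_tendsto_slope' Set.self_notMem_Ioi]
  refine ((hS.hasHilbertGenerator_map h hx).neg.comp (tendsto_sub_nhdsGT x)).congr' ?_
  filter_upwards [self_mem_nhdsWithin] with y hy
  have hy' : x < y := hy
  rw [Function.comp_apply, slope, vsub_eq_sub, ← hS.add _ _ (by linarith) hx, ← smul_neg, neg_sub,
    sub_add_cancel]

lemma continuous_inner_map (hS : IsSymmContractionSemigroup S) (f x : H) :
    Continuous fun t => inner ℝ (S t f) x :=
  (hS.cont f).inner continuous_const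

lemma inner_map_generator_nonneg (hS : IsSymmContractionSemigroup S) {f g : H}
    (h : HasHilbertGenerator S f g) {t : ℝ} (ht : 0 ≤ t) : 0 ≤ inner ℝ (S t g) f := by
  rw [hS.inner_map_eq ht]
  exact hS.inner_generator_nonneg (hS.hasHilbertGenerator_map h (by positivity))

lemma integral_map_map (hS : IsSymmContractionSemigroup S) (f : H) {r t : ℝ} (hr : 0 ≤ r)
    (ht : 0 ≤ t) : ∫ s in (0 : ℝ)..r, S s (S t f) = ∫ s in t..(t + r), S s f := by
  have hadd : ∫ s in (0 : ℝ)..r, S s (S t f) = ∫ s in (0 : ℝ)..r, S (t + s) f := by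
    refine intervalIntegral.integral_congr fun s hs => ?_
    rw [Set.uIcc_of_le hr] at hs
    rw [hS.add t s ht hs.1, hS.comm ht hs.1]
  rw [hadd, intervalIntegral.integral_comp_add_left (fun s => S s f), add_zero]

variable [CompleteSpace H]

lemma hasDerivAt_integral (hS : IsSymmContractionSemigroup S) (g : H) (t : ℝ) :
    HasDerivAt (fun t => ∫ s in (0 : ℝ)..t, S s g) (S t g) t :=
  ((hS.cont g).integral_hasStrictDerivAt 0 t).hasDerivAt

lemma sub_map_eq_integral (hS : IsSymmContractionSemigroup S) {f g : H}
    (h : HasHilbertGenerator S f g) {t : ℝ} (ht : 0 ≤ t) :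
    f - S t f = ∫ s in (0 : ℝ)..t, S s g := by
  have hderiv : ∀ x ∈ Set.Ico 0 t, HasDerivWithinAt
      (fun x => S x f + ∫ s in (0 : ℝ)..x, S s g) 0 (Set.Ici x) x := fun x hx => by
    simpa using! (hS.hasDerivWithinAt_orbit h hx.1).add
      (hS.hasDerivAt_integral g x).hasDerivWithinAt
  have hcont : Continuous fun x => S x f + ∫ s in (0 : ℝ)..x, S s g :=
    (hS.cont f).add (intervalIntegral.continuous_primitive
      (fun a b => (hS.cont g).intervalIntegrable a b) 0)
  have hconst := constant_of_has_deriv_right_zero hcont.continuousOn hderiv t ⟨ht, le_rfl⟩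
  simp only [intervalIntegral.integral_same, add_zero, hS.zero] at hconst
  rw [sub_eq_iff_eq_add', hconst]

lemma norm_sub_map_le (hS : IsSymmContractionSemigroup S) {f g : H}
    (h : HasHilbertGenerator S f g) {t : ℝ} (ht : 0 ≤ t) : ‖f - S t f‖ ≤ ‖g‖ * t := by
  rw [hS.sub_map_eq_integral h ht]
  simpa only [sub_zero, abs_of_nonneg ht] using
    intervalIntegral.norm_integral_le_of_norm_le_const (a := 0) (b := t) fun s _ => hS.contr s g

lemma hasHilbertGenerator_of_sub_map_eq (hS : IsSymmContractionSemigroup S) {f g : H}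
    (h : ∀ t, 0 ≤ t → f - S t f = ∫ s in (0 : ℝ)..t, S s g) : HasHilbertGenerator S f g := by
  have hslope := (hS.hasDerivAt_integral g 0).hasDerivWithinAt (s := Set.Ioi 0)
  rw [hasDerivWithinAt_iff_tendsto_slope' Set.self_notMem_Ioi, hS.zero] at hslope
  refine hslope.congr' ?_
  filter_upwards [self_mem_nhdsWithin] with s hs
  simp [slope, h s (le_of_lt hs)]

lemma hasDerivAt_orbit (hS : IsSymmContractionSemigroup S) {f g : H}
    (h : HasHilbertGenerator S f g) {t : ℝ} (ht : 0 < t) :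
    HasDerivAt (fun t => S t f) (-(S t g)) t := by
  refine ((hS.hasDerivAt_integral g t).const_sub f).congr_of_eventuallyEq ?_
  filter_upwards [lt_mem_nhds ht] with s hs
  rw [← hS.sub_map_eq_integral h hs.le, sub_sub_cancel]

lemma hasDerivAt_inner_orbit (hS : IsSymmContractionSemigroup S) {f g : H}
    (h : HasHilbertGenerator S f g) (x : H) {t : ℝ} (ht : 0 < t) :
    HasDerivAt (fun t => inner ℝ (S t f) x) (-(inner ℝ (S t g) x)) t := by
  simpa using (hS.hasDerivAt_orbit h ht).inner ℝ (hasDerivAt_const t x)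

lemma hasHilbertGenerator_integral (hS : IsSymmContractionSemigroup S) (f : H) {r : ℝ}
    (hr : 0 ≤ r) : HasHilbertGenerator S (∫ s in (0 : ℝ)..r, S s f) (f - S r f) := by
  refine hS.hasHilbertGenerator_of_sub_map_eq fun t ht => ?_
  have hint : ∀ (u : H) (a b : ℝ), IntervalIntegrable (fun s => S s u) volume a b :=
    fun u a b => (hS.cont u).intervalIntegrable a b
  have hmap : S t (∫ s in (0 : ℝ)..r, S s f) = ∫ s in t..(t + r), S s f := by
    rw [← ContinuousLinearMap.intervalIntegral_comp_comm _ (hint f _ _),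
      ← hS.integral_map_map f hr ht]
    refine intervalIntegral.integral_congr fun s hs => ?_
    rw [Set.uIcc_of_le hr] at hs
    exact hS.comm ht hs.1 f
  simp only [map_sub]
  rw [hmap, intervalIntegral.integral_sub (hint _ _ _) (hint _ _ _), hS.integral_map_map f ht hr,
    sub_eq_sub_iff_add_eq_add,
    intervalIntegral.integral_add_adjacent_intervals (hint f _ _) (hint f _ _), add_comm r t,
    intervalIntegral.integral_add_adjacent_intervals (hint f _ _) (hint f _ _)]

lemma exists_hasHilbertGenerator_tendsto (hS : IsSymmContractionSemigroup S) (f : H) :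
    ∃ u v : ℕ → H, (∀ n, HasHilbertGenerator S (u n) (v n)) ∧ Tendsto u atTop (𝓝 f) := by
  let r : ℕ → ℝ := fun n => 1 / ((n : ℝ) + 1)
  have hr0 : ∀ n, 0 < r n := fun n => Nat.one_div_pos_of_nat
  have hr : Tendsto r atTop (𝓝[>] 0) := tendsto_nhdsWithin_iff.2
    ⟨tendsto_one_div_add_atTop_nhds_zero_nat, Eventually.of_forall hr0⟩
  refine ⟨fun n => (r n)⁻¹ • ∫ s in (0 : ℝ)..(r n), S s f, fun n => (r n)⁻¹ • (f - S (r n) f),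
    fun n => (hS.hasHilbertGenerator_integral f (hr0 n).le).smul _, ?_⟩
  have hslope := (hS.hasDerivAt_integral f 0).hasDerivWithinAt (s := Set.Ioi 0)
  rw [hasDerivWithinAt_iff_tendsto_slope' Set.self_notMem_Ioi, hS.zero] at hslope
  refine (hslope.comp hr).congr fun n => ?_
  simp [slope]

lemma hasHilbertGenerator_of_tendsto (hS : IsSymmContractionSemigroup S) {ι : Type*}
    {l : Filter ι} [l.NeBot] {f g : H} {u v : ι → H} (h : ∀ i, HasHilbertGenerator S (u i) (v i))
    (hu : Tendsto u l (𝓝 f)) (hv : Tendsto v l (𝓝 g)) : HasHilbertGenerator S f g := by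
  refine hS.hasHilbertGenerator_of_sub_map_eq fun t ht => ?_
  have hlhs : Tendsto (fun i => u i - S t (u i)) l (𝓝 (f - S t f)) :=
    hu.sub (((S t).continuous.tendsto f).comp hu)
  have hrhs : Tendsto (fun i => ∫ s in (0 : ℝ)..t, S s (v i)) l
      (𝓝 (∫ s in (0 : ℝ)..t, S s g)) := by
    rw [tendsto_iff_norm_sub_tendsto_zero] at hv ⊢
    refine squeeze_zero (fun _ => norm_nonneg _) (fun i => ?_)
      (by simpa only [zero_mul] using hv.mul_const |t|)
    rw [← intervalIntegral.integral_sub ((hS.cont _).intervalIntegrable _ _)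
      ((hS.cont _).intervalIntegrable _ _)]
    have hcontr : ∀ s, ‖S s (v i) - S s g‖ ≤ ‖v i - g‖ := fun s => by
      rw [← map_sub]; exact hS.contr s _
    simpa only [sub_zero] using
      intervalIntegral.norm_integral_le_of_norm_le_const (a := 0) (b := t) fun s _ => hcontr s
  exact tendsto_nhds_unique hlhs (hrhs.congr fun i => (hS.sub_map_eq_integral (h i) ht).symm)

lemma hasDerivAt_inner_orbit_generator (hS : IsSymmContractionSemigroup S) {f g : H}
    (h : HasHilbertGenerator S f g) {t : ℝ} (ht : 0 < t) :
    HasDerivAt (fun t => inner ℝ (S t g) f) (-(inner ℝ (S t g) g)) t := by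
  refine (hS.hasDerivAt_inner_orbit h g ht).congr_of_eventuallyEq (.of_forall fun s => ?_)
  simp only [hS.symm s g f, real_inner_comm]

lemma norm_map_generator_le (hS : IsSymmContractionSemigroup S) {f g : H}
    (h : HasHilbertGenerator S f g) {t : ℝ} (ht : 0 < t) : ‖S t g‖ ≤ ‖f‖ / t := by
  have hle : t ^ 2 * inner ℝ (S (2 * t) g) g ≤ inner ℝ (S 0 f) f :=
    sq_mul_le_of_antitoneOn_deriv_deriv (hS.continuous_inner_map f f).continuousOn
      (fun s hs => hS.hasDerivAt_inner_orbit h f hs)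
      (fun s hs => hS.hasDerivAt_inner_orbit_generator h hs)
      (fun s hs => hS.inner_map_self_nonneg hs.le f)
      (fun s hs => hS.inner_map_generator_nonneg h hs.le)
      (fun s hs => hS.inner_map_self_nonneg hs.le g)
      ((hS.antitoneOn_inner_map_self g).mono Set.Ioi_subset_Ici_self) ht
  rw [hS.inner_map_self (by positivity), mul_div_cancel_left₀ t two_ne_zero, hS.zero,
    real_inner_self_eq_norm_sq, ← mul_pow] at hle
  rw [le_div_iff₀ ht, mul_comm]
  exact le_of_sq_le_sq hle (norm_nonneg f)

lemma exists_hasHilbertGenerator_map (hS : IsSymmContractionSemigroup S) (f : H) {t : ℝ}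
    (ht : 0 < t) : ∃ g, HasHilbertGenerator S (S t f) g := by
  obtain ⟨u, v, huv, hu⟩ := hS.exists_hasHilbertGenerator_tendsto f
  have hcauchy : CauchySeq fun n => S t (v n) := by
    rw [Metric.cauchySeq_iff']
    intro ε hε
    obtain ⟨N, hN⟩ := Metric.cauchySeq_iff'.1 hu.cauchySeq (ε * t) (by positivity)
    refine ⟨N, fun n hn => ?_⟩
    rw [dist_eq_norm, ← map_sub]
    refine (hS.norm_map_generator_le ((huv n).sub (huv N)) ht).trans_lt ?_
    rw [div_lt_iff₀ ht, ← dist_eq_norm]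
    exact hN n hn
  obtain ⟨g, hg⟩ := cauchySeq_tendsto_of_complete hcauchy
  exact ⟨g, hS.hasHilbertGenerator_of_tendsto
    (fun n => hS.hasHilbertGenerator_map (huv n) ht.le)
    (((S t).continuous.tendsto f).comp hu) hg⟩

lemma norm_map_le_exp_of_gap (hS : IsSymmContractionSemigroup S) {f g : H}
    (h : HasHilbertGenerator S f g) {σ : ℝ} (hσ : 0 < σ)
    (hgap : ∀ t, 0 ≤ t → σ * ‖S t f‖ ≤ ‖S t g‖) {t : ℝ} (ht : 0 ≤ t) :
    ‖S t f‖ ≤ Real.exp (-(σ * t)) * ‖f‖ := by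
  have hbound : ∀ s, inner ℝ (S s f) f ≤ ‖f‖ ^ 2 := fun s => calc
    inner ℝ (S s f) f ≤ ‖S s f‖ * ‖f‖ := real_inner_le_norm _ _
    _ ≤ ‖f‖ * ‖f‖ := by gcongr; exact hS.contr s f
    _ = ‖f‖ ^ 2 := (sq _).symm
  have hle : inner ℝ (S (2 * t) f) f ≤ Real.exp (-(σ * (2 * t))) * inner ℝ (S 0 f) f := by
    refine le_exp_mul_of_sq_mul_le_deriv_deriv hσ
      (hS.continuous_inner_map f f).continuousOn
      (fun s hs => hS.hasDerivAt_inner_orbit h f hs)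
      (fun s hs => hS.hasDerivAt_inner_orbit_generator h hs) (fun s _ => hbound s)
      (fun s hs => hS.inner_map_generator_nonneg h hs.le) (fun s hs => ?_) (by positivity)
    rw [hS.inner_map_self hs.le, hS.inner_map_self hs.le, ← mul_pow]
    gcongr
    exact hgap _ (by positivity)
  rw [hS.inner_map_self (by positivity), mul_div_cancel_left₀ t two_ne_zero, hS.zero,
    real_inner_self_eq_norm_sq] at hle
  refine le_of_sq_le_sq (hle.trans_eq ?_) (by positivity)
  rw [mul_pow, ← Real.exp_nat_mul]
  congr 2
  push_cast
  ring

end IsSymmContractionSemigroup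

end HilbertSemigroup

variable {Ω : Type*} [MeasurableSpace Ω] {μ : Measure Ω}

section LinfAlgebra

/-- Multiplication of `L_∞` as a continuous bilinear map; its values are those of `mulLinf`. -/
def mulL (μ : Measure Ω) : Linf μ →L[ℝ] Linf μ →L[ℝ] Linf μ :=
  (ContinuousLinearMap.mul ℝ ℝ).holderL μ ∞ ∞ ∞

lemma coeFn_mulLinf (f g : Linf μ) : ⇑(mulLinf f g) =ᵐ[μ] fun x => f x * g x :=
  MemLp.coeFn_toLp _

lemma mulLinf_assoc (f g h : Linf μ) : mulLinf (mulLinf f g) h = mulLinf f (mulLinf g h) :=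
  Lp.ext <| by
    filter_upwards [coeFn_mulLinf (mulLinf f g) h, coeFn_mulLinf f g, coeFn_mulLinf f (mulLinf g h),
      coeFn_mulLinf g h] with x hfg_h hfg hf_gh hgh
    rw [hfg_h, hf_gh, hfg, hgh, mul_assoc]

lemma mulLinf_comm (f g : Linf μ) : mulLinf f g = mulLinf g f :=
  Lp.ext <| by
    filter_upwards [coeFn_mulLinf f g, coeFn_mulLinf g f] with x hfg hgf
    rw [hfg, hgf, mul_comm]

lemma coeFn_sum_smul {ι : Type*} (s : Finset ι) (c : ι → ℝ) (f : ι → Linf μ) :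
    ⇑(∑ i ∈ s, c i • f i) =ᵐ[μ] fun x => ∑ i ∈ s, c i * f i x := by
  filter_upwards [Lp.coeFn_finsetSum s fun i => c i • f i,
    (Finset.eventually_all s).2 fun i _ => Lp.coeFn_smul (c i) (f i)] with x hsum hsmul
  rw [hsum, Finset.sum_apply]
  exact Finset.sum_congr rfl fun i hi => hsmul i hi

lemma linf_nonneg_iff {f : Linf μ} : 0 ≤ f ↔ ∀ᵐ x ∂μ, 0 ≤ f x := (Lp.coeFn_nonneg f).symm

lemma linf_ae_abs_le (f : Linf μ) : ∀ᵐ x ∂μ, |f x| ≤ ‖f‖ := by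
  rw [Lp.norm_def, toReal_eLpNorm (Lp.aestronglyMeasurable f)]
  exact ae_le_lpNorm_exponent_top (Lp.memLp f)

lemma exists_linf {u : Ω → ℝ} (hu : AEStronglyMeasurable u μ) {C : ℝ}
    (hC : ∀ᵐ x ∂μ, |u x| ≤ C) : ∃ f : Linf μ, ⇑f =ᵐ[μ] u :=
  ⟨(memLp_top_of_bound hu C hC).toLp u, MemLp.coeFn_toLp _⟩

lemma linf_mul_integrable (f : Linf μ) {γ : Ω → ℝ} (hγ : Integrable γ μ) :
    Integrable (fun x => f x * γ x) μ :=
  hγ.bdd_mul (Lp.memLp f).1 (linf_ae_abs_le f)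

variable [IsFiniteMeasure μ]

lemma one_mulLinf (f : Linf μ) : mulLinf (Lp.const ∞ μ (1 : ℝ)) f = f :=
  Lp.ext <| by
    filter_upwards [coeFn_mulLinf (Lp.const ∞ μ (1 : ℝ)) f, Lp.coeFn_const ∞ μ (1 : ℝ)]
      with x hmul hone
    rw [hmul, hone, Function.const_apply, one_mul]

/-- `L_∞` as a commutative ring under the pointwise product. -/
scoped instance instCommRingLinf : CommRing (Linf μ) :=
  { (inferInstance : AddCommGroup (Linf μ)) with
    mul := mulLinf
    one := Lp.const ∞ μ (1 : ℝ)
    mul_assoc := mulLinf_assoc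
    mul_comm := mulLinf_comm
    one_mul := one_mulLinf
    mul_one := fun f => (mulLinf_comm _ _).trans (one_mulLinf f)
    left_distrib := fun f => map_add (mulL μ f)
    right_distrib := fun f g => (mulL μ).map_add₂ f g
    zero_mul := fun f => (mulL μ).map_zero₂ f
    mul_zero := fun f => map_zero (mulL μ f) }

/-- The `ℝ`-algebra structure of `L_∞` given by the scalar multiplication of `Lp`. -/
scoped instance instAlgebraLinf : Algebra ℝ (Linf μ) :=
  Algebra.ofModule (fun r f g => (mulL μ).map_smul₂ r f g) fun r f => map_smul (mulL μ f) r

lemma hasDerivAt_linf_mul {f g : ℝ → Linf μ} {f' g' : Linf μ} {t : ℝ}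
    (hf : HasDerivAt f f' t) (hg : HasDerivAt g g' t) :
    HasDerivAt (fun s => f s * g s) (f t * g' + f' * g t) t :=
  (mulL μ).hasDerivAt_of_bilinear (fun _ => hf) (fun _ => hg)

lemma coeFn_mul (f g : Linf μ) : ⇑(f * g) =ᵐ[μ] fun x => f x * g x := coeFn_mulLinf f g

lemma coeFn_one : ⇑(1 : Linf μ) =ᵐ[μ] fun _ => (1 : ℝ) := Lp.coeFn_const ∞ μ (1 : ℝ)

lemma coeFn_smul_one (a : ℝ) : ⇑(a • (1 : Linf μ)) =ᵐ[μ] fun _ => a := by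
  filter_upwards [Lp.coeFn_smul a (1 : Linf μ), coeFn_one (μ := μ)] with x hsmul hone
  rw [hsmul, Pi.smul_apply, hone, smul_eq_mul, mul_one]

lemma coeFn_aeval (f : Linf μ) (p : Polynomial ℝ) :
    ⇑(Polynomial.aeval f p) =ᵐ[μ] fun x => p.eval (f x) := by
  induction p using Polynomial.induction_on' with
  | add p q hp hq =>
    rw [map_add]
    filter_upwards [Lp.coeFn_add (Polynomial.aeval f p) (Polynomial.aeval f q), hp, hq]
      with x hadd hpx hqx
    rw [hadd, Pi.add_apply, hpx, hqx, Polynomial.eval_add]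
  | monomial n a =>
    have hpow : ⇑(f ^ n) =ᵐ[μ] fun x => f x ^ n := by
      induction n with
      | zero => simpa only [pow_zero] using coeFn_one
      | succ n ih =>
        filter_upwards [coeFn_mul (f ^ n) f, ih] with x hmul hx
        rw [pow_succ, hmul, hx, pow_succ]
    rw [Polynomial.aeval_monomial, ← Algebra.smul_def]
    filter_upwards [Lp.coeFn_smul a (f ^ n), hpow] with x hsmul hx
    rw [hsmul, Pi.smul_apply, hx, Polynomial.eval_monomial, smul_eq_mul]

lemma smul_one_le_iff {a : ℝ} {f : Linf μ} : a • (1 : Linf μ) ≤ f ↔ ∀ᵐ x ∂μ, a ≤ f x := by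
  rw [← Lp.coeFn_le]
  exact eventually_congr ((coeFn_smul_one a).mono fun x hx => by rw [hx])

lemma le_smul_one_iff {a : ℝ} {f : Linf μ} : f ≤ a • (1 : Linf μ) ↔ ∀ᵐ x ∂μ, f x ≤ a := by
  rw [← Lp.coeFn_le]
  exact eventually_congr ((coeFn_smul_one a).mono fun x hx => by rw [hx])

lemma linf_mul_nonneg {f g : Linf μ} (hf : 0 ≤ f) (hg : 0 ≤ g) : 0 ≤ f * g := by
  rw [linf_nonneg_iff] at *
  filter_upwards [hf, hg, coeFn_mul f g] with x hfx hgx hmul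
  rw [hmul]; positivity

lemma linf_mul_self_nonneg (f : Linf μ) : 0 ≤ f * f :=
  linf_nonneg_iff.2 <| (coeFn_mul f f).mono fun x hx => by rw [hx]; exact mul_self_nonneg _

lemma linf_one_nonneg : (0 : Linf μ) ≤ 1 :=
  linf_nonneg_iff.2 <| coeFn_one.mono fun x hx => by rw [hx]; exact zero_le_one

lemma linf_le_norm_smul_one (f : Linf μ) : f ≤ ‖f‖ • (1 : Linf μ) :=
  le_smul_one_iff.2 <| (linf_ae_abs_le f).mono fun _ hx => (le_abs_self _).trans hx

lemma linf_integrable (f : Linf μ) : Integrable f μ :=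
  memLp_one_iff_integrable.1 ((Lp.memLp f).mono_exponent le_top)

end LinfAlgebra

section PositiveMaps

lemma ae_forall_nonneg {Q : Ω → ℝ → ℝ} (hc : ∀ x, Continuous (Q x))
    (h : ∀ a, ∀ᵐ x ∂μ, 0 ≤ Q x a) : ∀ᵐ x ∂μ, ∀ a, 0 ≤ Q x a := by
  filter_upwards [ae_all_iff.2 fun q : ℚ => h q] with x hx a
  exact Rat.isDenseEmbedding_coe_real.dense.induction_on (p := fun a => 0 ≤ Q x a) a
    (isClosed_le continuous_const (hc x)) hx

variable [IsFiniteMeasure μ] {P : Linf μ →L[ℝ] Linf μ}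

lemma map_mono_of_nonneg (hP : ∀ f, 0 ≤ f → 0 ≤ P f) {f g : Linf μ} (h : f ≤ g) : P f ≤ P g := by
  simpa only [map_sub, sub_nonneg] using hP _ (sub_nonneg.2 h)

lemma ae_le_map_of_ae_le (hP : ∀ f, 0 ≤ f → 0 ≤ P f) (hone : P 1 = 1) {f : Linf μ} {a : ℝ}
    (h : ∀ᵐ x ∂μ, a ≤ f x) : ∀ᵐ x ∂μ, a ≤ P f x := by
  rw [← smul_one_le_iff] at h ⊢
  simpa only [map_smul, hone] using map_mono_of_nonneg hP h

lemma map_ae_le_of_ae_le (hP : ∀ f, 0 ≤ f → 0 ≤ P f) (hone : P 1 = 1) {f : Linf μ} {a : ℝ}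
    (h : ∀ᵐ x ∂μ, f x ≤ a) : ∀ᵐ x ∂μ, P f x ≤ a := by
  rw [← le_smul_one_iff] at h ⊢
  simpa only [map_smul, hone] using map_mono_of_nonneg hP h

lemma ae_forall_map_sum_nonneg (hP : ∀ f, 0 ≤ f → 0 ≤ P f) {ι : Type*} [Fintype ι]
    (f : ι → Linf μ) {c : ι → ℝ → ℝ} (hc : ∀ i, Continuous (c i))
    (h : ∀ a, ∀ᵐ x ∂μ, 0 ≤ ∑ i, c i a * f i x) :
    ∀ᵐ x ∂μ, ∀ a, 0 ≤ ∑ i, c i a * P (f i) x := by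
  refine ae_forall_nonneg (fun x => by fun_prop) fun a => ?_
  have hsum : 0 ≤ ∑ i, c i a • f i := by
    rw [linf_nonneg_iff]
    filter_upwards [h a, coeFn_sum_smul Finset.univ (c · a) f] with x hx hcoe
    rwa [hcoe]
  have hmap := hP _ hsum
  simp only [map_sum, map_smul] at hmap
  filter_upwards [linf_nonneg_iff.1 hmap, coeFn_sum_smul Finset.univ (c · a) fun i => P (f i)]
    with x hx hcoe
  rwa [hcoe] at hx

lemma map_mul_self_le (hP : ∀ f, 0 ≤ f → 0 ≤ P f) (hone : P 1 = 1) (f : Linf μ) :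
    P f * P f ≤ P (f * f) := by
  have hsquare : ∀ᵐ x ∂μ, ∀ a : ℝ, 0 ≤ ∑ i : Fin 3, ![1, -(2 * a), a ^ 2] i *
      P (![f * f, f, 1] i) x := by
    refine ae_forall_map_sum_nonneg (c := fun i a => ![1, -(2 * a), a ^ 2] i) hP _
      (fun i => by fin_cases i; exacts [continuous_const, by fun_prop, continuous_pow 2])
      fun a => ?_
    filter_upwards [coeFn_mul f f, coeFn_one (μ := μ)] with x hmul hone
    simp only [Fin.sum_univ_three, Matrix.cons_val, hmul, hone]
    linarith [sq_nonneg (f x - a)]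
  rw [← Lp.coeFn_le]
  filter_upwards [hsquare, coeFn_mul (P f) (P f), coeFn_one (μ := μ)] with x hx hmul h1
  have := hx (P f x)
  simp only [Fin.sum_univ_three, Matrix.cons_val, hone, h1] at this
  rw [hmul]
  linarith

end PositiveMaps

section Expect

/-- Pairing of bounded functions with an integrable function. -/
def pairing (μ : Measure Ω) (γ : Lp ℝ 1 μ) : Linf μ →L[ℝ] ℝ :=
  ((ContinuousLinearMap.mul ℝ ℝ).lpPairing μ ∞ 1).flip γ

lemma pairing_apply (γ : Lp ℝ 1 μ) (f : Linf μ) : pairing μ γ f = ∫ x, f x * γ x ∂μ :=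
  ContinuousLinearMap.lpPairing_eq_integral _ _ _

variable [IsFiniteMeasure μ]

/-- The expectation `f ↦ ∫ f` on bounded functions. -/
def expect (μ : Measure Ω) [IsFiniteMeasure μ] : Linf μ →L[ℝ] ℝ :=
  pairing μ (Lp.const 1 μ (1 : ℝ))

lemma expect_apply (f : Linf μ) : expect μ f = ∫ x, f x ∂μ := by
  rw [expect, pairing_apply]
  refine integral_congr_ae ?_
  filter_upwards [Lp.coeFn_const 1 μ (1 : ℝ)] with x hx
  rw [hx, Function.const_apply, mul_one]

lemma expect_mul (f g : Linf μ) : expect μ (f * g) = ∫ x, f x * g x ∂μ := by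
  rw [expect_apply]; exact integral_congr_ae (coeFn_mul f g)

lemma expect_one [IsProbabilityMeasure μ] : expect μ 1 = 1 := by
  rw [expect_apply, integral_congr_ae coeFn_one]; simp

lemma expect_nonneg {f : Linf μ} (hf : 0 ≤ f) : 0 ≤ expect μ f := by
  rw [expect_apply]; exact integral_nonneg_of_ae (linf_nonneg_iff.1 hf)

lemma expect_mono {f g : Linf μ} (h : f ≤ g) : expect μ f ≤ expect μ g := by
  simpa only [map_sub, sub_nonneg] using expect_nonneg (sub_nonneg.2 h)

/-- The inclusion of `L_∞` in `L_2`. -/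
def toL2 (μ : Measure Ω) [IsFiniteMeasure μ] : Linf μ →L[ℝ] Lp ℝ 2 μ :=
  ((ContinuousLinearMap.mul ℝ ℝ).holderL μ ∞ 2 2).flip (Lp.const 2 μ (1 : ℝ))

lemma coeFn_toL2 (f : Linf μ) : ⇑(toL2 μ f) =ᵐ[μ] f := by
  filter_upwards [ContinuousLinearMap.coeFn_holder (r := 2) (ContinuousLinearMap.mul ℝ ℝ) f
    (Lp.const 2 μ (1 : ℝ)), Lp.coeFn_const 2 μ (1 : ℝ)] with x hmul hone
  exact hmul.trans (by rw [hone, Function.const_apply, ContinuousLinearMap.mul_apply', mul_one])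

lemma inner_toL2_left (f : Linf μ) (g : Lp ℝ 2 μ) : inner ℝ (toL2 μ f) g = ∫ x, f x * g x ∂μ := by
  rw [L2.inner_def]
  refine integral_congr_ae ?_
  filter_upwards [coeFn_toL2 f] with x hx
  simp only [hx, RCLike.inner_apply, conj_trivial, mul_comm]

lemma inner_toL2 (f g : Linf μ) : inner ℝ (toL2 μ f) (toL2 μ g) = expect μ (f * g) := by
  rw [inner_toL2_left, expect_mul]
  exact integral_congr_ae ((coeFn_toL2 g).mono fun x hx => by simp only [hx])

lemma norm_toL2_sq (f : Linf μ) : ‖toL2 μ f‖ ^ 2 = expect μ (f * f) := by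
  rw [← inner_toL2, real_inner_self_eq_norm_sq]

lemma denseRange_toL2 : DenseRange (toL2 μ) := by
  refine (Lp.simpleFunc.denseRange (E := ℝ) (μ := μ) (p := 2) (by norm_num)).mono ?_
  rintro _ ⟨s, rfl⟩
  let u := Lp.simpleFunc.toSimpleFunc s
  refine ⟨(u.memLp_top μ).toLp u, Lp.ext ?_⟩
  filter_upwards [coeFn_toL2 ((u.memLp_top μ).toLp u), MemLp.coeFn_toLp (u.memLp_top μ),
    Lp.simpleFunc.toSimpleFunc_eq_toFun s] with x hL2 htoLp hs
  rw [hL2, htoLp, ← hs]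

lemma toL2_injective : Function.Injective (toL2 μ) := by
  intro f g h
  refine Lp.ext ?_
  filter_upwards [coeFn_toL2 f, coeFn_toL2 g] with x hf hg
  rw [← hf, ← hg, h]

lemma integral_abs_le_norm_toL2 [IsProbabilityMeasure μ] (f : Linf μ) :
    ∫ x, |f x| ∂μ ≤ ‖toL2 μ f‖ := by
  rw [Lp.norm_def, eLpNorm_congr_ae (coeFn_toL2 f)]
  have hmono : eLpNorm f 1 μ ≤ eLpNorm f 2 μ :=
    eLpNorm_le_eLpNorm_of_exponent_le (by norm_num) (Lp.aestronglyMeasurable f)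
  refine le_trans (le_of_eq ?_) (ENNReal.toReal_mono ((Lp.memLp f).mono_exponent le_top).2.ne hmono)
  rw [toReal_eLpNorm (Lp.aestronglyMeasurable f),
    lpNorm_one_eq_integral_norm (Lp.aestronglyMeasurable f)]
  simp only [Real.norm_eq_abs]

end Expect

variable {T : ℝ → Linf μ →L[ℝ] Linf μ}

section L2Semigroup

variable [IsFiniteMeasure μ]

lemma IsMarkovSemigroup.map_one (hT : IsMarkovSemigroup T) {t : ℝ} (ht : 0 ≤ t) : T t 1 = 1 :=
  hT.unital t ht

lemma IsMarkovSemigroup.zero_apply (hT : IsMarkovSemigroup T) (f : Linf μ) : T 0 f = f := by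
  rw [hT.zero, ContinuousLinearMap.id_apply]

lemma IsMarkovSemigroup.add_apply (hT : IsMarkovSemigroup T) {s t : ℝ} (hs : 0 ≤ s) (ht : 0 ≤ t)
    (f : Linf μ) : T (s + t) f = T s (T t f) := by
  rw [hT.add s t hs ht, ContinuousLinearMap.comp_apply]

lemma IsSymmetricSemigroup.expect_symm (hs : IsSymmetricSemigroup T) {t : ℝ} (ht : 0 ≤ t)
    (f g : Linf μ) : expect μ (f * T t g) = expect μ (T t f * g) := by
  rw [expect_mul, expect_mul]; exact hs t ht f g

lemma expect_map (hT : IsMarkovSemigroup T) (hs : IsSymmetricSemigroup T) {t : ℝ} (ht : 0 ≤ t)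
    (f : Linf μ) : expect μ (T t f) = expect μ f := by
  simpa only [hT.map_one ht, one_mul] using hs.expect_symm ht 1 f

lemma norm_toL2_map_le (hT : IsMarkovSemigroup T) (hs : IsSymmetricSemigroup T) {t : ℝ}
    (ht : 0 ≤ t) (f : Linf μ) : ‖toL2 μ (T t f)‖ ≤ ‖toL2 μ f‖ := by
  rw [← sq_le_sq₀ (norm_nonneg _) (norm_nonneg _), norm_toL2_sq, norm_toL2_sq,
    ← expect_map hT hs ht (f * f)]
  exact expect_mono (map_mul_self_le (hT.nonneg t ht) (hT.map_one ht) f)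

/-- The extension of the semigroup to `L_2`, constant in time on `t ≤ 0`. -/
def l2Semigroup (T : ℝ → Linf μ →L[ℝ] Linf μ) (t : ℝ) : Lp ℝ 2 μ →L[ℝ] Lp ℝ 2 μ :=
  LinearMap.extendOfNorm ((toL2 μ ∘L T (max t 0)) : Linf μ →ₗ[ℝ] Lp ℝ 2 μ)
    (toL2 μ : Linf μ →ₗ[ℝ] Lp ℝ 2 μ)

lemma l2Semigroup_toL2 (hT : IsMarkovSemigroup T) (hs : IsSymmetricSemigroup T) (t : ℝ)
    (f : Linf μ) : l2Semigroup T t (toL2 μ f) = toL2 μ (T (max t 0) f) :=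
  LinearMap.extendOfNorm_eq (f := ((toL2 μ ∘L T (max t 0)) : Linf μ →ₗ[ℝ] Lp ℝ 2 μ))
    (e := (toL2 μ : Linf μ →ₗ[ℝ] Lp ℝ 2 μ)) denseRange_toL2
    ⟨1, fun x => by rw [one_mul]; exact norm_toL2_map_le hT hs (le_max_right _ _) x⟩ f

lemma l2Semigroup_toL2_of_nonneg (hT : IsMarkovSemigroup T) (hs : IsSymmetricSemigroup T) {t : ℝ}
    (ht : 0 ≤ t) (f : Linf μ) : l2Semigroup T t (toL2 μ f) = toL2 μ (T t f) := by
  rw [l2Semigroup_toL2 hT hs, max_eq_left ht]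

lemma norm_l2Semigroup_le (hT : IsMarkovSemigroup T) (hs : IsSymmetricSemigroup T) (t : ℝ)
    (f : Lp ℝ 2 μ) : ‖l2Semigroup T t f‖ ≤ ‖f‖ := by
  refine denseRange_toL2.induction_on (p := fun f => ‖l2Semigroup T t f‖ ≤ ‖f‖) f
    (isClosed_le (by fun_prop) (by fun_prop)) fun g => ?_
  rw [l2Semigroup_toL2 hT hs]
  exact norm_toL2_map_le hT hs (le_max_right _ _) g

lemma inner_toL2_map_map (hT : IsMarkovSemigroup T) (hs : IsSymmetricSemigroup T) {s t : ℝ}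
    (hs0 : 0 ≤ s) (ht0 : 0 ≤ t) (f : Linf μ) :
    inner ℝ (toL2 μ (T s f)) (toL2 μ (T t f)) = expect μ (f * T (s + t) f) := by
  rw [inner_toL2, hT.add_apply hs0 ht0, hs.expect_symm hs0]

lemma continuous_toL2_map (hT : IsMarkovSemigroup T) (hs : IsSymmetricSemigroup T) (f : Linf μ) :
    Continuous fun t => toL2 μ (T (max t 0) f) := by
  have hpair : ContinuousOn (fun t => expect μ (f * T t f)) (Set.Ici 0) := by
    simpa only [expect_mul] using hT.ultraweak_continuous f f (linf_integrable f)
  have hinner : ∀ {u v : ℝ → ℝ}, Continuous u → Continuous v → Continuous fun s =>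
      inner ℝ (toL2 μ (T (max (u s) 0) f)) (toL2 μ (T (max (v s) 0) f)) := fun hu hv => by
    simp only [inner_toL2_map_map hT hs (le_max_right _ _) (le_max_right _ _)]
    exact hpair.comp_continuous (by fun_prop)
      fun s => Set.mem_Ici.2 (add_nonneg (le_max_right _ _) (le_max_right _ _))
  exact continuous_of_continuous_inner (hinner continuous_id continuous_id)
    fun t => hinner continuous_id (continuous_const (y := t))

lemma continuous_l2Semigroup (hT : IsMarkovSemigroup T) (hs : IsSymmetricSemigroup T)
    (f : Lp ℝ 2 μ) : Continuous fun t => l2Semigroup T t f := by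
  refine continuous_of_uniform_approx_of_continuous fun u hu => ?_
  obtain ⟨ε, hε, hεu⟩ := Metric.mem_uniformity_dist.1 hu
  obtain ⟨g, hg⟩ := denseRange_toL2.exists_dist_lt f hε
  refine ⟨fun t => toL2 μ (T (max t 0) g), continuous_toL2_map hT hs g, fun t => hεu ?_⟩
  change dist _ (toL2 μ (T (max t 0) g)) < ε
  rw [← l2Semigroup_toL2 hT hs, dist_eq_norm, ← map_sub]
  exact (norm_l2Semigroup_le hT hs t _).trans_lt (by rwa [← dist_eq_norm])

lemma isSymmContractionSemigroup_l2Semigroup (hT : IsMarkovSemigroup T)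
    (hs : IsSymmetricSemigroup T) : IsSymmContractionSemigroup (l2Semigroup T) where
  zero f := by
    refine denseRange_toL2.induction_on (p := fun f => l2Semigroup T 0 f = f) f
      (isClosed_eq (by fun_prop) (by fun_prop)) fun g => ?_
    rw [l2Semigroup_toL2_of_nonneg hT hs le_rfl, hT.zero_apply]
  add s t hs0 ht0 f := by
    refine denseRange_toL2.induction_on
      (p := fun f => l2Semigroup T (s + t) f = l2Semigroup T s (l2Semigroup T t f)) f
      (isClosed_eq (by fun_prop) (by fun_prop)) fun g => ?_
    rw [l2Semigroup_toL2_of_nonneg hT hs ht0, l2Semigroup_toL2_of_nonneg hT hs hs0,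
      l2Semigroup_toL2_of_nonneg hT hs (add_nonneg hs0 ht0), hT.add_apply hs0 ht0]
  symm t f g := by
    refine denseRange_toL2.induction_on₂
      (p := fun f g => inner ℝ (l2Semigroup T t f) g = inner ℝ f (l2Semigroup T t g))
      (isClosed_eq (by fun_prop) (by fun_prop)) (fun u v => ?_) f g
    rw [l2Semigroup_toL2 hT hs, l2Semigroup_toL2 hT hs, inner_toL2, inner_toL2,
      hs.expect_symm (le_max_right _ _)]
  contr := norm_l2Semigroup_le hT hs
  cont := continuous_l2Semigroup hT hs

end L2Semigroup

section Generator

lemma HasGenerator.congr {f : Linf μ} {g h : Ω → ℝ} (hg : HasGenerator T f g) (hgh : g =ᵐ[μ] h) :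
    HasGenerator T f h :=
  ⟨(memLp_congr_ae hgh).1 hg.1,
    hg.2.congr fun _ => eLpNorm_congr_ae (hgh.mono fun x hx => by simp only [hx])⟩

variable [IsFiniteMeasure μ]

lemma hasGenerator_iff (hT : IsMarkovSemigroup T) (hs : IsSymmetricSemigroup T) {f : Linf μ}
    {g : Lp ℝ 2 μ} : HasGenerator T f g ↔ HasHilbertGenerator (l2Semigroup T) (toL2 μ f) g := by
  rw [HasGenerator, and_iff_right (Lp.memLp g), HasHilbertGenerator,
    Lp.tendsto_Lp_iff_tendsto_eLpNorm']
  refine tendsto_congr' ?_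
  filter_upwards [self_mem_nhdsWithin] with t ht
  refine eLpNorm_congr_ae ?_
  rw [l2Semigroup_toL2_of_nonneg hT hs (le_of_lt ht), ← map_sub, ← map_smul]
  filter_upwards [coeFn_toL2 (t⁻¹ • (f - T t f)), Lp.coeFn_smul t⁻¹ (f - T t f),
    Lp.coeFn_sub f (T t f)] with x hL2 hsmul hsub
  rw [Pi.sub_apply, hL2, hsmul, Pi.smul_apply, hsub, Pi.sub_apply, smul_eq_mul, div_eq_inv_mul]

lemma hasGenerator_iff_toLp (hT : IsMarkovSemigroup T) (hs : IsSymmetricSemigroup T) {f : Linf μ}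
    {g : Ω → ℝ} (hg : MemLp g 2 μ) :
    HasGenerator T f g ↔ HasHilbertGenerator (l2Semigroup T) (toL2 μ f) (hg.toLp g) := by
  rw [← hasGenerator_iff hT hs]
  exact ⟨fun h => h.congr hg.coeFn_toLp.symm, fun h => h.congr hg.coeFn_toLp⟩

lemma hasGenerator_iff_toL2 (hT : IsMarkovSemigroup T) (hs : IsSymmetricSemigroup T)
    {f g : Linf μ} :
    HasGenerator T f g ↔ HasHilbertGenerator (l2Semigroup T) (toL2 μ f) (toL2 μ g) := by
  rw [← hasGenerator_iff hT hs]
  exact ⟨fun h => h.congr (coeFn_toL2 g).symm, fun h => h.congr (coeFn_toL2 g)⟩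

lemma HasGenerator.tendsto_expect (hT : IsMarkovSemigroup T) (hs : IsSymmetricSemigroup T)
    {f : Linf μ} {g : Ω → ℝ} (h : HasGenerator T f g) (w : Linf μ) :
    Tendsto (fun t : ℝ => t⁻¹ * expect μ (w * (f - T t f))) (𝓝[>] 0) (𝓝 (∫ x, w x * g x ∂μ)) := by
  have hinner := Tendsto.inner (𝕜 := ℝ) (tendsto_const_nhds (x := toL2 μ w))
    ((hasGenerator_iff_toLp hT hs h.1).1 h)
  have hlim : inner ℝ (toL2 μ w) (h.1.toLp g) = ∫ x, w x * g x ∂μ := by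
    rw [inner_toL2_left]
    exact integral_congr_ae (h.1.coeFn_toLp.mono fun x hx => by simp only [hx])
  rw [hlim] at hinner
  refine hinner.congr' ?_
  filter_upwards [self_mem_nhdsWithin] with t ht
  rw [l2Semigroup_toL2_of_nonneg hT hs (le_of_lt ht), ← map_sub, real_inner_smul_right, inner_toL2]

lemma HasGenerator.unique {f g h : Linf μ} (hT : IsMarkovSemigroup T)
    (hs : IsSymmetricSemigroup T) (hg : HasGenerator T f g) (hh : HasGenerator T f h) : g = h := by
  rw [hasGenerator_iff_toL2 hT hs] at hg hh
  exact toL2_injective (tendsto_nhds_unique hg hh)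

lemma HasGenerator.map {f g : Linf μ} (hT : IsMarkovSemigroup T) (hs : IsSymmetricSemigroup T)
    (hg : HasGenerator T f g) {t : ℝ} (ht : 0 ≤ t) : HasGenerator T (T t f) (T t g) := by
  rw [hasGenerator_iff_toL2 hT hs] at hg ⊢
  simpa only [l2Semigroup_toL2_of_nonneg hT hs ht] using
    (isSymmContractionSemigroup_l2Semigroup hT hs).hasHilbertGenerator_map hg ht

end Generator

section Ultracontractive

variable [IsProbabilityMeasure μ]

lemma exists_l2_to_linf (hT : IsMarkovSemigroup T) (hs : IsSymmetricSemigroup T) {c d : ℝ}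
    (hV : VaropoulosBound T c d) (hc : 0 < c) {t : ℝ} (ht0 : 0 < t) (ht1 : t < 1) :
    ∃ U : Lp ℝ 2 μ →L[ℝ] Linf μ, (∀ f, U (toL2 μ f) = T t f) ∧
      ∀ f, toL2 μ (U f) = l2Semigroup T t f := by
  have hbound : ∀ f : Linf μ, ‖T t f‖ ≤ c * t ^ (-(d / 2)) * ‖toL2 μ f‖ := fun f =>
    (hV t ht0 ht1 f).trans
      (mul_le_mul_of_nonneg_left (integral_abs_le_norm_toL2 f) (by positivity))
  let U : Lp ℝ 2 μ →L[ℝ] Linf μ :=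
    LinearMap.extendOfNorm (T t : Linf μ →ₗ[ℝ] Linf μ) (toL2 μ : Linf μ →ₗ[ℝ] Lp ℝ 2 μ)
  have hU : ∀ f, U (toL2 μ f) = T t f :=
    LinearMap.extendOfNorm_eq (f := (T t : Linf μ →ₗ[ℝ] Linf μ))
      (e := (toL2 μ : Linf μ →ₗ[ℝ] Lp ℝ 2 μ)) denseRange_toL2 ⟨_, hbound⟩
  refine ⟨U, hU, fun f => ?_⟩
  refine denseRange_toL2.induction_on (p := fun f => toL2 μ (U f) = l2Semigroup T t f) f
    (isClosed_eq (by fun_prop) (by fun_prop)) fun g => ?_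
  rw [hU, l2Semigroup_toL2_of_nonneg hT hs ht0.le]

/-- The point is that the derivative is taken in the norm of `L_∞`: factor
`T_t = T_r ∘ T_{t - 2r} ∘ T_r`, where `T_r` smooths in `L_2` first and maps `L_2` to `L_∞` last. -/
lemma exists_hasDerivAt_hasGenerator (hT : IsMarkovSemigroup T) (hs : IsSymmetricSemigroup T)
    {c d : ℝ} (hV : VaropoulosBound T c d) (hc : 0 < c) (f : Linf μ) {t : ℝ} (ht : 0 < t) :
    ∃ g : Linf μ, HasDerivAt (fun s => T s f) (-g) t ∧ HasGenerator T (T t f) g := by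
  have hS := isSymmContractionSemigroup_l2Semigroup hT hs
  obtain ⟨r, hr0, hr1, hrt⟩ : ∃ r : ℝ, 0 < r ∧ r < 1 ∧ 2 * r < t :=
    ⟨min (t / 4) (1 / 2), by positivity, (min_le_right _ _).trans_lt (by norm_num),
      by linarith [min_le_left (t / 4) (1 / 2)]⟩
  obtain ⟨U, hU, hUS⟩ := exists_l2_to_linf hT hs hV hc hr0 hr1
  obtain ⟨g, hg⟩ := hS.exists_hasHilbertGenerator_map (toL2 μ f) hr0
  have hfactor : ∀ s, 2 * r < s → U (l2Semigroup T (s - 2 * r) (l2Semigroup T r (toL2 μ f))) =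
      T s f := fun s hrs => by
    rw [l2Semigroup_toL2_of_nonneg hT hs hr0.le, l2Semigroup_toL2_of_nonneg hT hs (by linarith),
      hU, ← hT.add_apply (by linarith) hr0.le, ← hT.add_apply hr0.le (by linarith)]
    congr 2; ring
  refine ⟨U (l2Semigroup T (t - 2 * r) g), ?_, ?_⟩
  · have horbit := (hS.hasDerivAt_orbit hg (t := t - 2 * r) (by linarith)).scomp t
      ((hasDerivAt_id t).sub_const (2 * r))
    have hderiv := U.hasFDerivAt.comp_hasDerivAt t horbit
    rw [one_smul, map_neg] at hderiv
    refine hderiv.congr_of_eventuallyEq ?_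
    filter_upwards [lt_mem_nhds hrt] with s hrs using (hfactor s hrs).symm
  · rw [hasGenerator_iff_toL2 hT hs, hUS, ← hfactor t hrt, hUS]
    exact hS.hasHilbertGenerator_map (hS.hasHilbertGenerator_map hg (by linarith)) hr0.le

end Ultracontractive

section ApproximateGradientForm

variable [IsFiniteMeasure μ]

/-- The gradient form of the bounded operator `(id - T_t) / t`, as an element of `L_∞`. -/
def gammaT (T : ℝ → Linf μ →L[ℝ] Linf μ) (t : ℝ) (f g : Linf μ) : Linf μ :=
  (2 * t)⁻¹ • (T t (f * g) - f * T t g - T t f * g + f * g)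

lemma coeFn_gammaT (t : ℝ) (f g : Linf μ) : ⇑(gammaT T t f g) =ᵐ[μ] fun x =>
    (2 * t)⁻¹ * (T t (f * g) x - f x * T t g x - T t f x * g x + f x * g x) := by
  filter_upwards [Lp.coeFn_smul (2 * t)⁻¹ (T t (f * g) - f * T t g - T t f * g + f * g),
    Lp.coeFn_add (T t (f * g) - f * T t g - T t f * g) (f * g),
    Lp.coeFn_sub (T t (f * g) - f * T t g) (T t f * g),
    Lp.coeFn_sub (T t (f * g)) (f * T t g), coeFn_mul f (T t g), coeFn_mul (T t f) g,
    coeFn_mul f g] with x hsmul hadd hsub₁ hsub₂ hmul₁ hmul₂ hmul₃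
  rw [gammaT, hsmul, Pi.smul_apply, hadd, Pi.add_apply, hsub₁, Pi.sub_apply, hsub₂, Pi.sub_apply,
    hmul₁, hmul₂, hmul₃, smul_eq_mul]

lemma approxGamma_ae_eq_gammaT (t : ℝ) (f g : Linf μ) :
    approxGamma T t f g =ᵐ[μ] gammaT T t f g := by
  filter_upwards [coeFn_gammaT (T := T) t f g, coeFn_mul f g] with x hgamma hmul
  change ((f x - T t f x) / t * g x + f x * ((g x - T t g x) / t)
    - ((f * g) x - T t (f * g) x) / t) / 2 = _
  rw [hgamma, hmul, mul_inv]
  ring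

lemma gammaT_comm (t : ℝ) (f g : Linf μ) : gammaT T t f g = gammaT T t g f := by
  rw [gammaT, gammaT, mul_comm f g, mul_comm f, mul_comm _ g, sub_right_comm]

lemma gammaT_add_left (t : ℝ) (f g h : Linf μ) :
    gammaT T t (f + g) h = gammaT T t f h + gammaT T t g h := by
  simp only [gammaT, add_mul, map_add]; module

lemma gammaT_smul_left (t a : ℝ) (f h : Linf μ) : gammaT T t (a • f) h = a • gammaT T t f h := by
  simp only [gammaT, smul_mul_assoc, map_smul]; module

lemma gammaT_add_right (t : ℝ) (f g h : Linf μ) :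
    gammaT T t f (g + h) = gammaT T t f g + gammaT T t f h := by
  simp only [gammaT_comm t f, gammaT_add_left]

lemma gammaT_smul_right (t a : ℝ) (f h : Linf μ) : gammaT T t f (a • h) = a • gammaT T t f h := by
  simp only [gammaT_comm t f, gammaT_smul_left]

lemma expect_gammaT (hT : IsMarkovSemigroup T) (hs : IsSymmetricSemigroup T) {t : ℝ} (ht : 0 ≤ t)
    (f g : Linf μ) : expect μ (gammaT T t f g) = t⁻¹ * expect μ (f * (g - T t g)) := by
  simp only [gammaT, map_smul, map_add, map_sub, mul_sub, smul_eq_mul]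
  rw [expect_map hT hs ht, hs.expect_symm ht f g, mul_inv]
  ring

lemma expect_mul_gammaT (hs : IsSymmetricSemigroup T) {t : ℝ} (ht : 0 ≤ t) (φ f g : Linf μ) :
    expect μ (φ * gammaT T t f g) = (t⁻¹ * expect μ (φ * f * (g - T t g)) +
      t⁻¹ * expect μ (φ * g * (f - T t f)) - t⁻¹ * expect μ (f * g * (φ - T t φ))) / 2 := by
  have hexpand : φ * gammaT T t f g = (2 * t)⁻¹ • (φ * f * (g - T t g) + φ * g * (f - T t f)
      - φ * (f * g) + φ * T t (f * g)) := by
    rw [gammaT, mul_smul_comm]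
    congr 1
    ring
  simp only [hexpand, map_smul, map_add, map_sub, smul_eq_mul, mul_sub (f * g)]
  rw [hs.expect_symm ht, mul_inv, mul_comm (f * g) φ, mul_comm (f * g) (T t φ)]
  ring

lemma gammaT_self_nonneg (hT : IsMarkovSemigroup T) {t : ℝ} (ht : 0 ≤ t) (g : Linf μ) :
    0 ≤ gammaT T t g g := by
  rw [linf_nonneg_iff]
  filter_upwards [coeFn_gammaT (T := T) t g g, coeFn_mul (T t g) (T t g),
    (Lp.coeFn_le _ _).2 (map_mul_self_le (hT.nonneg t ht) (hT.map_one ht) g)]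
    with x hgamma hmul hle
  rw [hmul] at hle
  rw [hgamma]
  exact mul_nonneg (by positivity) (by linarith [sq_nonneg (g x - T t g x)])

lemma ae_forall_sq_map_sub_le (hT : IsMarkovSemigroup T) {t : ℝ} (ht : 0 ≤ t) {ψ : ℝ → ℝ}
    {K : NNReal} (hψ : LipschitzWith K ψ) {g F : Linf μ} (hF : ∀ᵐ x ∂μ, F x = ψ (g x)) :
    ∀ᵐ x ∂μ, ∀ a, T t (F * F) x - 2 * ψ a * T t F x + ψ a ^ 2 ≤
      K ^ 2 * (T t (g * g) x - 2 * a * T t g x + a ^ 2) := by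
  have hcont := hψ.continuous
  have hsum := ae_forall_map_sum_nonneg (hT.nonneg t ht) ![g * g, g, F * F, F, 1]
    (c := fun i a => ![(K : ℝ) ^ 2, -(2 * K ^ 2 * a), -1, 2 * ψ a, K ^ 2 * a ^ 2 - ψ a ^ 2] i)
    (fun i => by fin_cases i <;> dsimp <;> fun_prop) fun a => by
      filter_upwards [hF, coeFn_mul g g, coeFn_mul F F, coeFn_one (μ := μ)] with x hFx hg hF hone
      simp only [Fin.sum_univ_five, Matrix.cons_val, hg, hF, hone, hFx]
      have hlip : |ψ (g x) - ψ a| ≤ |K * (g x - a)| := by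
        rw [abs_mul, NNReal.abs_eq]
        exact hψ.dist_le_mul (g x) a
      linarith [sq_le_sq.2 hlip]
  filter_upwards [hsum, coeFn_one (μ := μ)] with x hx hone a
  have hxa := hx a
  simp only [Fin.sum_univ_five, Matrix.cons_val, hT.map_one ht, hone] at hxa
  linarith

lemma gammaT_comp_le (hT : IsMarkovSemigroup T) {t : ℝ} (ht : 0 ≤ t) {ψ : ℝ → ℝ} {s : Set ℝ}
    {K : NNReal} (hψ : LipschitzOnWith K ψ s) {g F : Linf μ} (hg : ∀ᵐ x ∂μ, g x ∈ s)
    (hF : ∀ᵐ x ∂μ, F x = ψ (g x)) : gammaT T t F F ≤ ((K : ℝ) ^ 2) • gammaT T t g g := by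
  obtain ⟨η, hη, hψη⟩ := hψ.extend_real
  have hFη : ∀ᵐ x ∂μ, F x = η (g x) := by
    filter_upwards [hg, hF] with x hgx hFx
    rw [hFx, hψη hgx]
  rw [← Lp.coeFn_le]
  filter_upwards [ae_forall_sq_map_sub_le hT ht hη hFη, hFη, coeFn_gammaT (T := T) t F F,
    coeFn_gammaT (T := T) t g g, Lp.coeFn_smul ((K : ℝ) ^ 2) (gammaT T t g g)]
    with x hx hFx hgammaF hgammag hsmul
  have hxg := hx (g x)
  rw [← hFx] at hxg
  rw [hsmul, Pi.smul_apply, hgammaF, hgammag, smul_eq_mul, mul_left_comm]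
  exact mul_le_mul_of_nonneg_left (by linarith) (by positivity)

end ApproximateGradientForm

section DirichletAlgebra

variable [IsFiniteMeasure μ]

lemma inDirichletAlgebra_iff (hT : IsMarkovSemigroup T) (hs : IsSymmetricSemigroup T)
    {f : Linf μ} :
    InDirichletAlgebra T f ↔ ∃ C : ℝ, ∀ t, 0 < t → expect μ (gammaT T t f f) ≤ C := by
  refine exists_congr fun C => forall₂_congr fun t ht => ?_
  have hsub : ∫ x, f x * (f - T t f) x ∂μ = ∫ x, f x * (f x - T t f x) ∂μ :=
    integral_congr_ae ((Lp.coeFn_sub f (T t f)).mono fun x hx => by simp only [hx, Pi.sub_apply])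
  rw [expect_gammaT hT hs ht.le, expect_mul, inv_mul_eq_div, hsub]

lemma InDirichletAlgebra.comp (hT : IsMarkovSemigroup T) (hs : IsSymmetricSemigroup T)
    {g F : Linf μ} (hg : InDirichletAlgebra T g) {ψ : ℝ → ℝ} {s : Set ℝ} {K : NNReal}
    (hψ : LipschitzOnWith K ψ s) (hgs : ∀ᵐ x ∂μ, g x ∈ s) (hF : ∀ᵐ x ∂μ, F x = ψ (g x)) :
    InDirichletAlgebra T F := by
  rw [inDirichletAlgebra_iff hT hs] at *
  obtain ⟨C, hC⟩ := hg
  refine ⟨(K : ℝ) ^ 2 * C, fun t ht => (expect_mono (gammaT_comp_le hT ht.le hψ hgs hF)).trans ?_⟩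
  rw [map_smul, smul_eq_mul]
  exact mul_le_mul_of_nonneg_left (hC t ht) (by positivity)

lemma InDirichletAlgebra.add (hT : IsMarkovSemigroup T) (hs : IsSymmetricSemigroup T)
    {f g : Linf μ} (hf : InDirichletAlgebra T f) (hg : InDirichletAlgebra T g) :
    InDirichletAlgebra T (f + g) := by
  rw [inDirichletAlgebra_iff hT hs] at *
  obtain ⟨C, hC⟩ := hf
  obtain ⟨D, hD⟩ := hg
  refine ⟨2 * C + 2 * D, fun t ht => ?_⟩
  have hparallelogram : gammaT T t (f + g) (f + g) + gammaT T t (f + (-1 : ℝ) • g)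
      (f + (-1 : ℝ) • g) = (2 : ℝ) • gammaT T t f f + (2 : ℝ) • gammaT T t g g := by
    simp only [gammaT_add_left, gammaT_add_right, gammaT_smul_left, gammaT_smul_right]
    module
  have hexpect := congrArg (expect μ) hparallelogram
  simp only [map_add, map_smul, smul_eq_mul] at hexpect
  have hnonneg := expect_nonneg (gammaT_self_nonneg hT ht.le (f + (-1 : ℝ) • g))
  linarith [hC t ht, hD t ht]

lemma InDirichletAlgebra.smul (hT : IsMarkovSemigroup T) (hs : IsSymmetricSemigroup T)
    {f : Linf μ} (hf : InDirichletAlgebra T f) (a : ℝ) : InDirichletAlgebra T (a • f) := by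
  rw [inDirichletAlgebra_iff hT hs] at *
  obtain ⟨C, hC⟩ := hf
  refine ⟨a ^ 2 * C, fun t ht => ?_⟩
  rw [gammaT_smul_left, gammaT_smul_right, smul_smul, map_smul, smul_eq_mul, ← sq]
  exact mul_le_mul_of_nonneg_left (hC t ht) (by positivity)

lemma InDirichletAlgebra.sub (hT : IsMarkovSemigroup T) (hs : IsSymmetricSemigroup T)
    {f g : Linf μ} (hf : InDirichletAlgebra T f) (hg : InDirichletAlgebra T g) :
    InDirichletAlgebra T (f - g) := by
  simpa only [neg_one_smul, ← sub_eq_add_neg] using hf.add hT hs (hg.smul hT hs (-1))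

lemma HasGenerator.inDirichletAlgebra (hT : IsMarkovSemigroup T) (hs : IsSymmetricSemigroup T)
    {f : Linf μ} {g : Ω → ℝ} (h : HasGenerator T f g) : InDirichletAlgebra T f := by
  rw [inDirichletAlgebra_iff hT hs]
  refine ⟨‖toL2 μ f‖ * ‖h.1.toLp g‖, fun t ht => ?_⟩
  rw [expect_gammaT hT hs ht.le, ← inner_toL2, map_sub, ← l2Semigroup_toL2_of_nonneg hT hs ht.le,
    inv_mul_le_iff₀ ht, mul_left_comm, mul_comm t]
  exact (real_inner_le_norm _ _).trans <| mul_le_mul_of_nonneg_left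
    ((isSymmContractionSemigroup_l2Semigroup hT hs).norm_sub_map_le
      ((hasGenerator_iff_toLp hT hs h.1).1 h) ht.le) (norm_nonneg _)

end DirichletAlgebra

section GradientForm

lemma HasGamma.congr {f g : Linf μ} {γ γ' : Ω → ℝ} (h : HasGamma T f g γ) (hγ : γ =ᵐ[μ] γ') :
    HasGamma T f g γ' :=
  ⟨h.1.congr hγ, h.2.congr fun _ => eLpNorm_congr_ae (hγ.mono fun x hx => by simp only [hx])⟩

open Classical in
/-- The gradient form `Γ(f, g)` as an element of `L_1`, with value `0` where it does not exist. -/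
def carre (T : ℝ → Linf μ →L[ℝ] Linf μ) (f g : Linf μ) : Lp ℝ 1 μ :=
  if h : ∃ γ : Lp ℝ 1 μ, HasGamma T f g γ then h.choose else 0

lemma hasGamma_carre (hd : IsDiffusion T) {f g : Linf μ} (hf : InDirichletAlgebra T f)
    (hg : InDirichletAlgebra T g) : HasGamma T f g (carre T f g) := by
  obtain ⟨γ, hγ⟩ := hd.exists_gamma f g hf hg
  have hmem := memLp_one_iff_integrable.2 hγ.1
  have h : ∃ γ : Lp ℝ 1 μ, HasGamma T f g γ := ⟨hmem.toLp γ, hγ.congr hmem.coeFn_toLp.symm⟩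
  rw [carre, dif_pos h]
  exact h.choose_spec

/-- The functional `φ ↦ ∫ φ Γ(f, g)`. -/
def carreInt (T : ℝ → Linf μ →L[ℝ] Linf μ) (f g : Linf μ) : Linf μ →L[ℝ] ℝ :=
  pairing μ (carre T f g)

lemma carreInt_apply (f g φ : Linf μ) : carreInt T f g φ = ∫ x, φ x * carre T f g x ∂μ :=
  pairing_apply _ _

variable [IsFiniteMeasure μ]

lemma HasGamma.tendsto {f g : Linf μ} {γ : Ω → ℝ} (h : HasGamma T f g γ) (φ : Linf μ) :
    Tendsto (fun t : ℝ => expect μ (φ * gammaT T t f g)) (𝓝[>] 0) (𝓝 (∫ x, φ x * γ x ∂μ)) := by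
  have hmem : ∀ t, MemLp (gammaT T t f g) 1 μ := fun t => (Lp.memLp _).mono_exponent le_top
  have hγ := memLp_one_iff_integrable.2 h.1
  have hL1 : Tendsto (fun t => (hmem t).toLp (gammaT T t f g)) (𝓝[>] 0) (𝓝 (hγ.toLp γ)) :=
    (Lp.tendsto_Lp_iff_tendsto_eLpNorm'' _ hmem γ hγ).2 <| h.2.congr fun t => eLpNorm_congr_ae <|
      (approxGamma_ae_eq_gammaT (T := T) t f g).mono fun x hx => by simp only [hx, Pi.sub_apply]
  have hpair : ∀ {u : Ω → ℝ} (hu : MemLp u 1 μ),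
      (ContinuousLinearMap.mul ℝ ℝ).lpPairing μ ∞ 1 φ (hu.toLp u) = ∫ x, φ x * u x ∂μ :=
    fun hu => (ContinuousLinearMap.lpPairing_eq_integral _ _ _).trans <| integral_congr_ae <|
      hu.coeFn_toLp.mono fun x hx => by simp only [hx, ContinuousLinearMap.mul_apply']
  have hlim := (((ContinuousLinearMap.mul ℝ ℝ).lpPairing μ ∞ 1 φ).continuous.tendsto _).comp hL1
  simpa only [hpair, Function.comp_def, ← expect_mul] using hlim

lemma tendsto_carreInt (hd : IsDiffusion T) {f g : Linf μ} (hf : InDirichletAlgebra T f)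
    (hg : InDirichletAlgebra T g) (φ : Linf μ) :
    Tendsto (fun t : ℝ => expect μ (φ * gammaT T t f g)) (𝓝[>] 0) (𝓝 (carreInt T f g φ)) := by
  rw [carreInt_apply]
  exact (hasGamma_carre hd hf hg).tendsto φ

lemma carreInt_comm (hd : IsDiffusion T) {f g : Linf μ} (hf : InDirichletAlgebra T f)
    (hg : InDirichletAlgebra T g) (φ : Linf μ) : carreInt T f g φ = carreInt T g f φ :=
  tendsto_nhds_unique (tendsto_carreInt hd hf hg φ)
    ((tendsto_carreInt hd hg hf φ).congr fun t => by rw [gammaT_comm])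

lemma carreInt_add_left (hT : IsMarkovSemigroup T) (hs : IsSymmetricSemigroup T)
    (hd : IsDiffusion T) {f g h : Linf μ} (hf : InDirichletAlgebra T f)
    (hg : InDirichletAlgebra T g) (hh : InDirichletAlgebra T h) (φ : Linf μ) :
    carreInt T (f + g) h φ = carreInt T f h φ + carreInt T g h φ :=
  tendsto_nhds_unique (tendsto_carreInt hd (hf.add hT hs hg) hh φ)
    (((tendsto_carreInt hd hf hh φ).add (tendsto_carreInt hd hg hh φ)).congr fun t => by
      rw [gammaT_add_left, mul_add, map_add])

lemma carreInt_smul_left (hT : IsMarkovSemigroup T) (hs : IsSymmetricSemigroup T)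
    (hd : IsDiffusion T) {f h : Linf μ} (hf : InDirichletAlgebra T f)
    (hh : InDirichletAlgebra T h) (a : ℝ) (φ : Linf μ) :
    carreInt T (a • f) h φ = a * carreInt T f h φ :=
  tendsto_nhds_unique (tendsto_carreInt hd (hf.smul hT hs a) hh φ)
    (((tendsto_carreInt hd hf hh φ).const_mul a).congr fun t => by
      rw [gammaT_smul_left, mul_smul_comm, map_smul, smul_eq_mul])

lemma carreInt_add_smul_self (hT : IsMarkovSemigroup T) (hs : IsSymmetricSemigroup T)
    (hd : IsDiffusion T) {f g : Linf μ} (hf : InDirichletAlgebra T f)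
    (hg : InDirichletAlgebra T g) (a : ℝ) (φ : Linf μ) :
    carreInt T (f + a • g) (f + a • g) φ =
      carreInt T f f φ + 2 * a * carreInt T f g φ + a ^ 2 * carreInt T g g φ := by
  have hfg := hf.add hT hs (hg.smul hT hs a)
  refine tendsto_nhds_unique (tendsto_carreInt hd hfg hfg φ)
    ((((tendsto_carreInt hd hf hf φ).add ((tendsto_carreInt hd hf hg φ).const_mul (2 * a))).add
      ((tendsto_carreInt hd hg hg φ).const_mul (a ^ 2))).congr fun t => ?_)
  simp only [gammaT_add_left, gammaT_add_right, gammaT_smul_left, gammaT_smul_right,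
    gammaT_comm t g f, mul_add, mul_smul_comm, map_add, map_smul, smul_eq_mul]
  ring

lemma carreInt_self_nonneg (hT : IsMarkovSemigroup T) (hd : IsDiffusion T) {f : Linf μ}
    (hf : InDirichletAlgebra T f) {φ : Linf μ} (hφ : 0 ≤ φ) : 0 ≤ carreInt T f f φ := by
  refine ge_of_tendsto (tendsto_carreInt hd hf hf φ) ?_
  filter_upwards [self_mem_nhdsWithin] with t ht
  exact expect_nonneg (linf_mul_nonneg hφ (gammaT_self_nonneg hT (le_of_lt ht) f))

lemma carreInt_mul_left (hd : IsDiffusion T) {f g h : Linf μ} (hf : InDirichletAlgebra T f)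
    (hh : InDirichletAlgebra T h) (hg : InDirichletAlgebra T g)
    (hfh : InDirichletAlgebra T (f * h)) (φ : Linf μ) :
    carreInt T (f * h) g φ = carreInt T h g (φ * f) + carreInt T f g (φ * h) := by
  have hprod := (hd.product_rule f h g hf hh hg _ _ (hasGamma_carre hd hh hg)
    (hasGamma_carre hd hf hg)).tendsto φ
  refine (tendsto_nhds_unique (tendsto_carreInt hd hfh hg φ) hprod).trans ?_
  rw [carreInt_apply, carreInt_apply, ← integral_add
    (linf_mul_integrable _ (hasGamma_carre hd hh hg).1)
    (linf_mul_integrable _ (hasGamma_carre hd hf hg).1)]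
  refine integral_congr_ae ?_
  filter_upwards [coeFn_mul φ f, coeFn_mul φ h] with x hφf hφh
  rw [hφf, hφh]; ring

lemma carreInt_comp_le (hT : IsMarkovSemigroup T) (hs : IsSymmetricSemigroup T)
    (hd : IsDiffusion T) {ψ : ℝ → ℝ} {s : Set ℝ} {K : NNReal} (hψ : LipschitzOnWith K ψ s)
    {g F : Linf μ} (hg : InDirichletAlgebra T g) (hgs : ∀ᵐ x ∂μ, g x ∈ s)
    (hF : ∀ᵐ x ∂μ, F x = ψ (g x)) {φ : Linf μ} (hφ : 0 ≤ φ) :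
    carreInt T F F φ ≤ (K : ℝ) ^ 2 * carreInt T g g φ := by
  have hFd := hg.comp hT hs hψ hgs hF
  refine le_of_tendsto_of_tendsto (tendsto_carreInt hd hFd hFd φ)
    ((tendsto_carreInt hd hg hg φ).const_mul _) ?_
  filter_upwards [self_mem_nhdsWithin] with t ht
  have hle := linf_mul_nonneg hφ (sub_nonneg.2 (gammaT_comp_le hT (le_of_lt ht) hψ hgs hF))
  rw [mul_sub, sub_nonneg, mul_smul_comm] at hle
  simpa only [map_smul, smul_eq_mul] using expect_mono hle

lemma sq_carreInt_le (hT : IsMarkovSemigroup T) (hs : IsSymmetricSemigroup T)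
    (hd : IsDiffusion T) {f g : Linf μ} (hf : InDirichletAlgebra T f)
    (hg : InDirichletAlgebra T g) {φ : Linf μ} (hφ : 0 ≤ φ) :
    carreInt T f g φ ^ 2 ≤ carreInt T f f φ * carreInt T g g φ := by
  have hdiscrim : discrim (carreInt T g g φ) (2 * carreInt T f g φ) (carreInt T f f φ) ≤ 0 :=
    discrim_le_zero fun a => by
      have hsq := carreInt_self_nonneg hT hd (hf.add hT hs (hg.smul hT hs a)) hφ
      rw [carreInt_add_smul_self hT hs hd hf hg] at hsq
      linarith
  rw [discrim] at hdiscrim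
  linarith

lemma carreInt_one_of_hasGenerator (hT : IsMarkovSemigroup T) (hs : IsSymmetricSemigroup T)
    (hd : IsDiffusion T) {f g : Linf μ} {Ag : Ω → ℝ} (hf : InDirichletAlgebra T f)
    (hg : HasGenerator T g Ag) : carreInt T f g 1 = ∫ x, f x * Ag x ∂μ := by
  refine tendsto_nhds_unique (tendsto_carreInt hd hf (hg.inDirichletAlgebra hT hs) 1)
    ((hg.tendsto_expect hT hs f).congr' ?_)
  filter_upwards [self_mem_nhdsWithin] with t ht
  rw [one_mul, expect_gammaT hT hs (le_of_lt ht)]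

lemma carreInt_of_hasGenerator (hT : IsMarkovSemigroup T) (hs : IsSymmetricSemigroup T)
    (hd : IsDiffusion T) {f g φ Af Ag Aφ : Linf μ} (hf : HasGenerator T f Af)
    (hg : HasGenerator T g Ag) (hφ : HasGenerator T φ Aφ) : carreInt T f g φ =
      (expect μ (φ * f * Ag) + expect μ (φ * g * Af) - expect μ (f * g * Aφ)) / 2 := by
  have hgf := hg.tendsto_expect hT hs (φ * f)
  have hfg := hf.tendsto_expect hT hs (φ * g)
  have hφf := hφ.tendsto_expect hT hs (f * g)
  rw [← expect_mul] at hgf hfg hφf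
  refine tendsto_nhds_unique (tendsto_carreInt hd (hf.inDirichletAlgebra hT hs)
    (hg.inDirichletAlgebra hT hs) φ) ((((hgf.add hfg).sub hφf).div_const 2).congr' ?_)
  filter_upwards [self_mem_nhdsWithin] with t ht
  rw [expect_mul_gammaT hs (le_of_lt ht)]

lemma tendsto_carreInt_map (hT : IsMarkovSemigroup T) (f g φ : Linf μ) :
    Tendsto (fun v => carreInt T f g (T v φ)) (𝓝[>] 0) (𝓝 (carreInt T f g φ)) := by
  have hlim := (hT.ultraweak_continuous φ (carre T f g) (L1.integrable_coeFn _) 0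
    (Set.mem_Ici.2 le_rfl)).tendsto.mono_left (nhdsWithin_mono 0 Set.Ioi_subset_Ici_self)
  simpa only [carreInt_apply, hT.zero_apply, mul_comm] using hlim

end GradientForm

section ChainRule

lemma exists_derivative_eq (p : Polynomial ℝ) : ∃ q : Polynomial ℝ, q.derivative = p := by
  induction p using Polynomial.induction_on' with
  | add p₁ p₂ h₁ h₂ =>
    obtain ⟨q₁, rfl⟩ := h₁
    obtain ⟨q₂, rfl⟩ := h₂
    exact ⟨q₁ + q₂, Polynomial.derivative_add⟩
  | monomial n a =>
    refine ⟨Polynomial.monomial (n + 1) (a / (n + 1)), ?_⟩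
    rw [Polynomial.derivative_monomial, Nat.cast_succ, Nat.add_sub_cancel,
      div_mul_cancel₀ _ n.cast_add_one_ne_zero]

lemma linf_ae_mem_Icc (f : Linf μ) : ∀ᵐ x ∂μ, f x ∈ Set.Icc (-‖f‖) ‖f‖ :=
  (linf_ae_abs_le f).mono fun _ => abs_le.1

variable [IsFiniteMeasure μ]

lemma InDirichletAlgebra.comp_contDiffOn (hT : IsMarkovSemigroup T) (hs : IsSymmetricSemigroup T)
    {g F : Linf μ} (hg : InDirichletAlgebra T g) {ψ : ℝ → ℝ} {a b : ℝ}
    (hψ : ContDiffOn ℝ 1 ψ (Set.Icc a b)) (hgab : ∀ᵐ x ∂μ, g x ∈ Set.Icc a b)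
    (hF : ∀ᵐ x ∂μ, F x = ψ (g x)) : InDirichletAlgebra T F := by
  obtain ⟨K, hK⟩ := hψ.exists_lipschitzOnWith one_ne_zero (convex_Icc a b) isCompact_Icc
  exact hg.comp hT hs hK hgab hF

lemma InDirichletAlgebra.aeval (hT : IsMarkovSemigroup T) (hs : IsSymmetricSemigroup T)
    {g : Linf μ} (hg : InDirichletAlgebra T g) (p : Polynomial ℝ) :
    InDirichletAlgebra T (Polynomial.aeval g p) :=
  hg.comp_contDiffOn hT hs (p.contDiff_aeval 1).contDiffOn (linf_ae_mem_Icc g) (coeFn_aeval g p)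

lemma carreInt_one_left (hd : IsDiffusion T) {h : Linf μ} (h₁ : InDirichletAlgebra T (1 : Linf μ))
    (hh : InDirichletAlgebra T h) (φ : Linf μ) : carreInt T 1 h φ = 0 := by
  have hmul := carreInt_mul_left hd h₁ h₁ hh (by rwa [one_mul]) φ
  rw [mul_one, mul_one] at hmul
  linarith

lemma carreInt_aeval (hT : IsMarkovSemigroup T) (hs : IsSymmetricSemigroup T)
    (hd : IsDiffusion T) {g h : Linf μ} (hg : InDirichletAlgebra T g)
    (hh : InDirichletAlgebra T h) (p : Polynomial ℝ) (φ : Linf μ) :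
    carreInt T (Polynomial.aeval g p) h φ =
      carreInt T g h (φ * Polynomial.aeval g p.derivative) := by
  induction p using Polynomial.induction_on generalizing φ with
  | C a =>
    have h₁ : InDirichletAlgebra T (1 : Linf μ) := by simpa only [map_one] using hg.aeval hT hs 1
    rw [Polynomial.aeval_C, Algebra.algebraMap_eq_smul_one, carreInt_smul_left hT hs hd h₁ hh,
      carreInt_one_left hd h₁ hh, Polynomial.derivative_C, map_zero, mul_zero, mul_zero, map_zero]
  | add p q hp hq =>
    rw [map_add, carreInt_add_left hT hs hd (hg.aeval hT hs p) (hg.aeval hT hs q) hh, hp, hq,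
      Polynomial.derivative_add, map_add, mul_add, map_add]
  | monomial n a ih =>
    have hmul : Polynomial.aeval g (Polynomial.C a * Polynomial.X ^ (n + 1)) =
        Polynomial.aeval g (Polynomial.C a * Polynomial.X ^ n) * g := by
      rw [pow_succ, ← mul_assoc, map_mul, Polynomial.aeval_X]
    rw [hmul, carreInt_mul_left hd (hg.aeval hT hs _) hg hh (hmul ▸ hg.aeval hT hs _), ih,
      pow_succ, ← mul_assoc, Polynomial.derivative_mul (g := Polynomial.X),
      Polynomial.derivative_X, mul_one, map_add (Polynomial.aeval g), map_mul _ _ Polynomial.X,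
      Polynomial.aeval_X, ← map_add]
    congr 1
    ring

lemma norm_mul_le_of_ae_abs_le (φ : Linf μ) {u : Linf μ} {ε : ℝ} (hε : 0 ≤ ε)
    (hu : ∀ᵐ x ∂μ, |u x| ≤ ε) : ‖φ * u‖ ≤ ‖φ‖ * ε := by
  have hbound : ∀ᵐ x ∂μ, ‖(φ * u) x‖ ≤ ‖φ‖ * ε := by
    filter_upwards [coeFn_mul φ u, linf_ae_abs_le φ, hu] with x hmul hφ hu
    rw [hmul, norm_mul]
    exact mul_le_mul hφ hu (norm_nonneg _) (norm_nonneg _)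
  simpa using Lp.norm_le_of_ae_bound (by positivity) hbound

lemma abs_carreInt_comp_le (hT : IsMarkovSemigroup T) (hs : IsSymmetricSemigroup T)
    (hd : IsDiffusion T) {g h F : Linf μ} (hg : InDirichletAlgebra T g)
    (hh : InDirichletAlgebra T h) {ψ : ℝ → ℝ} {s : Set ℝ} {K : NNReal}
    (hψ : LipschitzOnWith K ψ s) (hgs : ∀ᵐ x ∂μ, g x ∈ s) (hF : ∀ᵐ x ∂μ, F x = ψ (g x))
    {φ : Linf μ} (hφ : 0 ≤ φ) :
    |carreInt T F h φ| ≤ K * √(carreInt T g g φ * carreInt T h h φ) := by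
  have hsq := (sq_carreInt_le hT hs hd (hg.comp hT hs hψ hgs hF) hh hφ).trans
    (mul_le_mul_of_nonneg_right (carreInt_comp_le hT hs hd hψ hg hgs hF hφ)
      (carreInt_self_nonneg hT hd hh hφ))
  refine (Real.abs_le_sqrt hsq).trans_eq ?_
  rw [mul_assoc, Real.sqrt_mul (sq_nonneg _), Real.sqrt_sq K.coe_nonneg]

lemma abs_carreInt_comp_sub_le (hT : IsMarkovSemigroup T) (hs : IsSymmetricSemigroup T)
    (hd : IsDiffusion T) {g h F G : Linf μ} (hg : InDirichletAlgebra T g)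
    (hh : InDirichletAlgebra T h) {ψ : ℝ → ℝ} (hψ : ContDiff ℝ 1 ψ)
    (hF : ∀ᵐ x ∂μ, F x = ψ (g x)) (hG : ∀ᵐ x ∂μ, G x = deriv ψ (g x)) {φ : Linf μ} (hφ : 0 ≤ φ)
    {ε : NNReal} (hε : 0 < ε) :
    |carreInt T F h φ - carreInt T g h (φ * G)| ≤
      ε * (√(carreInt T g g φ * carreInt T h h φ) + ‖carreInt T g h‖ * ‖φ‖) := by
  obtain ⟨p, hp⟩ := exists_polynomial_near_of_continuousOn (-‖g‖) ‖g‖ (deriv ψ)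
    (hψ.continuous_deriv le_rfl).continuousOn ε hε
  obtain ⟨q, rfl⟩ := exists_derivative_eq p
  set Q := Polynomial.aeval g q
  set Q' := Polynomial.aeval g q.derivative
  have hFd := hg.comp_contDiffOn hT hs hψ.contDiffOn (linf_ae_mem_Icc g) hF
  have hQd := hg.aeval hT hs q
  have hlip : LipschitzOnWith ε (fun y => ψ y - q.eval y) (Set.Icc (-‖g‖) ‖g‖) :=
    (convex_Icc _ _).lipschitzOnWith_of_nnnorm_hasDerivWithin_le
      (fun y _ => ((hψ.differentiable one_ne_zero y).hasDerivAt.sub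
        (q.hasDerivAt y)).hasDerivWithinAt)
      fun y hy => NNReal.coe_le_coe.1 ((norm_sub_rev _ _).trans_le (hp y hy).le)
  have hrest : |carreInt T (F - Q) h φ| ≤ ε * √(carreInt T g g φ * carreInt T h h φ) := by
    refine abs_carreInt_comp_le hT hs hd hg hh hlip (linf_ae_mem_Icc g) ?_ hφ
    filter_upwards [hF, coeFn_aeval g q, Lp.coeFn_sub F Q] with x hFx hQx hsub
    rw [hsub, Pi.sub_apply, hFx, hQx]
  have hpoly : |carreInt T g h (φ * (Q' - G))| ≤ ‖carreInt T g h‖ * (‖φ‖ * ε) := by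
    refine ((carreInt T g h).le_opNorm _).trans ?_
    gcongr
    refine norm_mul_le_of_ae_abs_le φ ε.coe_nonneg ?_
    filter_upwards [hG, coeFn_aeval g q.derivative, Lp.coeFn_sub Q' G, linf_ae_mem_Icc g]
      with x hGx hQx hsub hgx
    rw [hsub, Pi.sub_apply, hGx, hQx]
    exact (hp _ hgx).le
  have hsplit : carreInt T F h φ - carreInt T g h (φ * G) =
      carreInt T (F - Q) h φ + carreInt T g h (φ * (Q' - G)) := by
    have hadd := carreInt_add_left hT hs hd (hFd.sub hT hs hQd) hQd hh φ
    rw [sub_add_cancel, carreInt_aeval hT hs hd hg hh] at hadd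
    rw [hadd, mul_sub, map_sub]
    ring
  rw [hsplit]
  linarith [abs_add_le (carreInt T (F - Q) h φ) (carreInt T g h (φ * (Q' - G)))]

lemma carreInt_comp (hT : IsMarkovSemigroup T) (hs : IsSymmetricSemigroup T)
    (hd : IsDiffusion T) {g h F G : Linf μ} (hg : InDirichletAlgebra T g)
    (hh : InDirichletAlgebra T h) {ψ : ℝ → ℝ} (hψ : ContDiff ℝ 1 ψ)
    (hF : ∀ᵐ x ∂μ, F x = ψ (g x)) (hG : ∀ᵐ x ∂μ, G x = deriv ψ (g x)) {φ : Linf μ}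
    (hφ : 0 ≤ φ) : carreInt T F h φ = carreInt T g h (φ * G) := by
  have hlim : Tendsto (fun ε : NNReal => (ε : ℝ) * (√(carreInt T g g φ * carreInt T h h φ) +
      ‖carreInt T g h‖ * ‖φ‖)) (𝓝[>] 0) (𝓝 0) :=
    tendsto_nhdsWithin_of_tendsto_nhds (Continuous.tendsto' (by fun_prop) _ _ (zero_mul _))
  refine sub_eq_zero.1 (abs_nonpos_iff.1 (ge_of_tendsto hlim ?_))
  filter_upwards [self_mem_nhdsWithin] with ε hε
  exact abs_carreInt_comp_sub_le hT hs hd hg hh hψ hF hG hφ hε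

end ChainRule

section Regularization

/-- The bounded function `A T_s f`, as the negative of the derivative of `r ↦ T_r f` in `L_∞`;
meaningful for `s > 0` when the semigroup is smoothing. -/
def genMap (T : ℝ → Linf μ →L[ℝ] Linf μ) (s : ℝ) (f : Linf μ) : Linf μ :=
  -deriv (fun r => T r f) s

/-- The bounded function `A² T_s f`, as `A T_{s/2} (A T_{s/2} f)`. -/
def genSqMap (T : ℝ → Linf μ →L[ℝ] Linf μ) (s : ℝ) (f : Linf μ) : Linf μ :=
  genMap T (s / 2) (genMap T (s / 2) f)

variable [IsProbabilityMeasure μ]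

lemma hasDerivAt_map (hT : IsMarkovSemigroup T) (hs : IsSymmetricSemigroup T) {c d : ℝ}
    (hV : VaropoulosBound T c d) (hc : 0 < c) (f : Linf μ) {s : ℝ} (h0 : 0 < s) :
    HasDerivAt (fun r => T r f) (-genMap T s f) s := by
  obtain ⟨g, hderiv, -⟩ := exists_hasDerivAt_hasGenerator hT hs hV hc f h0
  rw [genMap, neg_neg]
  exact hderiv.differentiableAt.hasDerivAt

lemma hasGenerator_genMap (hT : IsMarkovSemigroup T) (hs : IsSymmetricSemigroup T) {c d : ℝ}
    (hV : VaropoulosBound T c d) (hc : 0 < c) (f : Linf μ) {s : ℝ} (h0 : 0 < s) :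
    HasGenerator T (T s f) (genMap T s f) := by
  obtain ⟨g, hderiv, hg⟩ := exists_hasDerivAt_hasGenerator hT hs hV hc f h0
  rwa [genMap, hderiv.deriv, neg_neg]

lemma genMap_add (hT : IsMarkovSemigroup T) (hs : IsSymmetricSemigroup T) {c d : ℝ}
    (hV : VaropoulosBound T c d) (hc : 0 < c) (f : Linf μ) {r s : ℝ} (hr : 0 ≤ r) (h0 : 0 < s) :
    genMap T (r + s) f = T r (genMap T s f) := by
  have hgen := (hasGenerator_genMap hT hs hV hc f h0).map hT hs hr
  rw [← hT.add_apply hr h0.le] at hgen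
  exact (hasGenerator_genMap hT hs hV hc f (by positivity)).unique hT hs hgen

lemma hasDerivAt_genMap (hT : IsMarkovSemigroup T) (hs : IsSymmetricSemigroup T) {c d : ℝ}
    (hV : VaropoulosBound T c d) (hc : 0 < c) (f : Linf μ) {s : ℝ} (h0 : 0 < s) :
    HasDerivAt (fun r => genMap T r f) (-genSqMap T s f) s := by
  have hderiv : HasDerivAt (fun r => T (r - s / 2) (genMap T (s / 2) f)) (-genSqMap T s f) s :=
    HasDerivAt.comp_sub_const (f := fun r => T r (genMap T (s / 2) f)) s (s / 2)
      (by rw [sub_half]; exact hasDerivAt_map hT hs hV hc _ (half_pos h0))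
  refine hderiv.congr_of_eventuallyEq ?_
  filter_upwards [lt_mem_nhds (half_lt_self h0)] with r hr
  rw [← genMap_add hT hs hV hc f (sub_nonneg.2 hr.le) (half_pos h0), sub_add_cancel]

lemma hasGenerator_genSqMap (hT : IsMarkovSemigroup T) (hs : IsSymmetricSemigroup T) {c d : ℝ}
    (hV : VaropoulosBound T c d) (hc : 0 < c) (f : Linf μ) {s : ℝ} (h0 : 0 < s) :
    HasGenerator T (genMap T s f) (genSqMap T s f) := by
  have hgen := hasGenerator_genMap hT hs hV hc (genMap T (s / 2) f) (half_pos h0)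
  rwa [← genMap_add hT hs hV hc f (half_pos h0).le (half_pos h0), add_halves] at hgen

lemma inDirichletAlgebra_map (hT : IsMarkovSemigroup T) (hs : IsSymmetricSemigroup T) {c d : ℝ}
    (hV : VaropoulosBound T c d) (hc : 0 < c) (f : Linf μ) {s : ℝ} (h0 : 0 < s) :
    InDirichletAlgebra T (T s f) :=
  (hasGenerator_genMap hT hs hV hc f h0).inDirichletAlgebra hT hs

end Regularization

section GradientEstimate

variable [IsProbabilityMeasure μ]

lemma CurvatureDimension.le (hT : IsMarkovSemigroup T) (hs : IsSymmetricSemigroup T)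
    (hd : IsDiffusion T) {lam : ℝ} (hCD : CurvatureDimension T lam) {f Af A2f φ Aφ : Linf μ}
    (hf : HasGenerator T f Af) (hAf : HasGenerator T Af A2f) (hφ : 0 ≤ φ)
    (hAφ : HasGenerator T φ Aφ) :
    lam * carreInt T f f φ ≤ carreInt T Af f φ - carreInt T f f Aφ / 2 := by
  have hfd := hf.inDirichletAlgebra hT hs
  have hAfd := hAf.inDirichletAlgebra hT hs
  have hle := hCD f Af hf hAfd _ _ _ (hasGamma_carre hd hfd hfd) (hasGamma_carre hd hAfd hfd)
    (hasGamma_carre hd hfd hAfd) φ Aφ hφ hAφ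
  simp only [← carreInt_apply] at hle
  rw [carreInt_comm hd hfd hAfd] at hle
  linarith

lemma hasDerivAt_carreInt (hT : IsMarkovSemigroup T) (hs : IsSymmetricSemigroup T)
    (hd : IsDiffusion T) {F K Φ P : ℝ → Linf μ} {f' k' φ' p' : Linf μ} {s : ℝ}
    (hFK : ∀ᶠ r in 𝓝 s, HasGenerator T (F r) (K r)) (hΦP : ∀ᶠ r in 𝓝 s, HasGenerator T (Φ r) (P r))
    (hF : HasDerivAt F (-f') s) (hK : HasDerivAt K (-k') s) (hΦ : HasDerivAt Φ φ' s)
    (hP : HasDerivAt P p' s) (hfk : HasGenerator T f' k') (hφp : HasGenerator T φ' p') :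
    HasDerivAt (fun r => carreInt T (F r) (F r) (Φ r))
      (-(2 * carreInt T f' (F s) (Φ s) - carreInt T (F s) (F s) φ')) s := by
  have hexpect := ((expect μ).hasFDerivAt.comp_hasDerivAt s
    (hasDerivAt_linf_mul (hasDerivAt_linf_mul hΦ hF) hK)).sub
      (((expect μ).hasFDerivAt.comp_hasDerivAt s
        (hasDerivAt_linf_mul (hasDerivAt_linf_mul hF hF) hP)).div_const 2)
  refine (hexpect.congr_of_eventuallyEq ?_).congr_deriv ?_
  · filter_upwards [hFK, hΦP] with r hr hφr
    rw [carreInt_of_hasGenerator hT hs hd hr hr hφr]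
    simp only [Pi.sub_apply, Function.comp_apply]
    ring
  · rw [carreInt_of_hasGenerator hT hs hd hfk hFK.self_of_nhds hΦP.self_of_nhds,
      carreInt_of_hasGenerator hT hs hd hFK.self_of_nhds hFK.self_of_nhds hφp]
    have hleft : Φ s * F s * -k' + (Φ s * -f' + φ' * F s) * K s =
        φ' * F s * K s - Φ s * F s * k' - Φ s * f' * K s := by ring
    have hright : F s * F s * p' + (F s * -f' + -f' * F s) * P s =
        F s * F s * p' - (2 : ℝ) • (f' * F s * P s) := by
      rw [two_smul]; ring
    rw [hleft, hright]
    simp only [map_sub, map_smul, smul_eq_mul]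
    ring

lemma hasDerivAt_carreInt_map (hT : IsMarkovSemigroup T) (hs : IsSymmetricSemigroup T)
    (hd : IsDiffusion T) {c d : ℝ} (hV : VaropoulosBound T c d) (hc : 0 < c) (g φ : Linf μ)
    {u w s : ℝ} (hu : 0 < u + s) (hw : 0 < w - s) :
    HasDerivAt (fun s => carreInt T (T (u + s) g) (T (u + s) g) (T (w - s) φ))
      (-(2 * carreInt T (genMap T (u + s) g) (T (u + s) g) (T (w - s) φ) -
        carreInt T (T (u + s) g) (T (u + s) g) (genMap T (w - s) φ))) s := by
  have hΦ : HasDerivAt (fun s => T (w - s) φ) (genMap T (w - s) φ) s := by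
    simpa using (hasDerivAt_map hT hs hV hc φ hw).comp_const_sub w s
  have hP : HasDerivAt (fun s => genMap T (w - s) φ) (genSqMap T (w - s) φ) s := by
    simpa using (hasDerivAt_genMap hT hs hV hc φ hw).comp_const_sub w s
  refine hasDerivAt_carreInt hT hs hd ?_ ?_ ((hasDerivAt_map hT hs hV hc g hu).comp_const_add u s)
    ((hasDerivAt_genMap hT hs hV hc g hu).comp_const_add u s) hΦ hP
    (hasGenerator_genSqMap hT hs hV hc g hu) (hasGenerator_genSqMap hT hs hV hc φ hw)
  · filter_upwards [(continuous_const_add u).continuousAt.eventually (lt_mem_nhds hu)] with r hr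
    exact hasGenerator_genMap hT hs hV hc g hr
  · filter_upwards [(continuous_sub_left w).continuousAt.eventually (lt_mem_nhds hw)] with r hr
    exact hasGenerator_genMap hT hs hV hc φ hr

lemma gradient_estimate_smooth (hT : IsMarkovSemigroup T) (hs : IsSymmetricSemigroup T)
    (hd : IsDiffusion T) {lam : ℝ} (hCD : CurvatureDimension T lam) {c d : ℝ}
    (hV : VaropoulosBound T c d) (hc : 0 < c) (g : Linf μ) {φ : Linf μ} (hφ : 0 ≤ φ)
    {t u v : ℝ} (ht : 0 ≤ t) (hu : 0 < u) (hv : 0 < v) :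
    Real.exp (2 * lam * t) * carreInt T (T (u + t) g) (T (u + t) g) (T v φ) ≤
      carreInt T (T u g) (T u g) (T (v + t) φ) := by
  have hderiv : ∀ s ∈ Set.Icc 0 t, _ := fun s hst =>
    hasDerivAt_carreInt_map (u := u) (w := v + t) hT hs hd hV hc g φ
      (add_pos_of_pos_of_nonneg hu hst.1) (by linarith [hst.2] : 0 < v + t - s)
  have hanti := antitoneOn_exp_mul (a := 2 * lam) (convex_Icc 0 t)
    (fun s hst => (hderiv s hst).continuousAt.continuousWithinAt)
    (fun s hst => hderiv s (interior_subset hst)) fun s hst => ?_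
  · simpa using hanti (Set.left_mem_Icc.2 ht) (Set.right_mem_Icc.2 ht) ht
  · obtain ⟨h0, h1⟩ := interior_subset hst
    have hu' : 0 < u + s := by positivity
    have hw' : 0 < v + t - s := by linarith
    have hle := hCD.le hT hs hd (hasGenerator_genMap hT hs hV hc g hu')
      (hasGenerator_genSqMap hT hs hV hc g hu') (hT.nonneg _ hw'.le φ hφ)
      (hasGenerator_genMap hT hs hV hc φ hw')
    linarith

lemma gradient_estimate (hT : IsMarkovSemigroup T) (hs : IsSymmetricSemigroup T)
    (hd : IsDiffusion T) {lam : ℝ} (hCD : CurvatureDimension T lam) {c d : ℝ}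
    (hV : VaropoulosBound T c d) (hc : 0 < c) (g : Linf μ) {φ : Linf μ} (hφ : 0 ≤ φ)
    {t u : ℝ} (ht : 0 ≤ t) (hu : 0 < u) :
    Real.exp (2 * lam * t) * carreInt T (T (u + t) g) (T (u + t) g) φ ≤
      carreInt T (T u g) (T u g) (T t φ) := by
  refine le_of_tendsto_of_tendsto ((tendsto_carreInt_map hT _ _ φ).const_mul _)
    (tendsto_carreInt_map hT _ _ (T t φ)) ?_
  filter_upwards [self_mem_nhdsWithin] with v hv
  rw [← hT.add_apply (le_of_lt hv) ht]
  exact gradient_estimate_smooth hT hs hd hCD hV hc g hφ ht hu hv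

end GradientEstimate

section Energy

variable [IsProbabilityMeasure μ]

lemma HasGenerator.expect_symm {f g Af Ag : Linf μ} (hT : IsMarkovSemigroup T)
    (hs : IsSymmetricSemigroup T) (hf : HasGenerator T f Af) (hg : HasGenerator T g Ag) :
    expect μ (f * Ag) = expect μ (g * Af) := by
  rw [expect_mul, expect_mul]
  refine tendsto_nhds_unique (hg.tendsto_expect hT hs f)
    ((hf.tendsto_expect hT hs g).congr' ?_)
  filter_upwards [self_mem_nhdsWithin] with t ht
  rw [mul_sub, mul_sub, map_sub, map_sub, hs.expect_symm (le_of_lt ht), mul_comm g f,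
    mul_comm (T t g) f]

lemma carreInt_genMap (hT : IsMarkovSemigroup T) (hs : IsSymmetricSemigroup T)
    (hd : IsDiffusion T) {c d : ℝ} (hV : VaropoulosBound T c d) (hc : 0 < c) {f : Linf μ}
    (hf : InDirichletAlgebra T f) (g : Linf μ) {s : ℝ} (h0 : 0 < s) :
    carreInt T f (T s g) 1 = expect μ (f * genMap T s g) := by
  rw [expect_mul, carreInt_one_of_hasGenerator hT hs hd hf (hasGenerator_genMap hT hs hV hc g h0)]

lemma expect_mul_genMap (hT : IsMarkovSemigroup T) (hs : IsSymmetricSemigroup T)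
    (hd : IsDiffusion T) {c d : ℝ} (hV : VaropoulosBound T c d) (hc : 0 < c) (g : Linf μ)
    {s : ℝ} (h0 : 0 < s) :
    expect μ (g * genMap T s g) = carreInt T (T (s / 2) g) (T (s / 2) g) 1 := by
  rw [carreInt_genMap hT hs hd hV hc (inDirichletAlgebra_map hT hs hV hc g (half_pos h0)) g
    (half_pos h0), ← hs.expect_symm (half_pos h0).le,
    ← genMap_add hT hs hV hc g (half_pos h0).le (half_pos h0), add_halves]

lemma antitoneOn_carreInt_map (hT : IsMarkovSemigroup T) (hs : IsSymmetricSemigroup T)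
    (hd : IsDiffusion T) {c d : ℝ} (hV : VaropoulosBound T c d) (hc : 0 < c) (g : Linf μ) :
    AntitoneOn (fun s => carreInt T (T s g) (T s g) 1) (Set.Ioi 0) := by
  have hderiv : ∀ s ∈ Set.Ioi (0 : ℝ), HasDerivAt (fun s => expect μ (T s g * genMap T s g))
      (-(2 * expect μ (genMap T s g * genMap T s g))) s := fun s h0 => by
    refine ((expect μ).hasFDerivAt.comp_hasDerivAt s (hasDerivAt_linf_mul
      (hasDerivAt_map hT hs hV hc g h0) (hasDerivAt_genMap hT hs hV hc g h0))).congr_deriv ?_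
    rw [mul_neg, neg_mul, map_add, map_neg, map_neg,
      (hasGenerator_genMap hT hs hV hc g h0).expect_symm hT hs
        (hasGenerator_genSqMap hT hs hV hc g h0)]
    ring
  refine AntitoneOn.congr (antitoneOn_of_hasDerivWithinAt_nonpos (convex_Ioi 0)
    (fun s h0 => (hderiv s h0).continuousAt.continuousWithinAt)
    (fun s h0 => (hderiv s (interior_subset h0)).hasDerivWithinAt) fun s _ => ?_) fun s h0 =>
      (carreInt_genMap hT hs hd hV hc (inDirichletAlgebra_map hT hs hV hc g h0) g h0).symm
  exact neg_nonpos.2 (mul_nonneg zero_le_two (expect_nonneg (linf_mul_self_nonneg _)))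

lemma carreInt_map_sub_le (hT : IsMarkovSemigroup T) (hs : IsSymmetricSemigroup T)
    (hd : IsDiffusion T) {c d : ℝ} (hV : VaropoulosBound T c d) (hc : 0 < c) {g : Linf μ}
    (hg : InDirichletAlgebra T g) {s : ℝ} (h0 : 0 < s) :
    carreInt T (T s g - g) (T s g - g) 1 ≤
      carreInt T g g 1 - carreInt T (T (s / 2) g) (T (s / 2) g) 1 := by
  have hTg := inDirichletAlgebra_map hT hs hV hc g h0
  have hexpand := carreInt_add_smul_self hT hs hd hTg hg (-1) 1
  rw [neg_one_smul, ← sub_eq_add_neg, carreInt_comm hd hTg hg,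
    carreInt_genMap hT hs hd hV hc hg g h0, expect_mul_genMap hT hs hd hV hc g h0] at hexpand
  have hanti : carreInt T (T s g) (T s g) 1 ≤ carreInt T (T (s / 2) g) (T (s / 2) g) 1 :=
    antitoneOn_carreInt_map hT hs hd hV hc g (Set.mem_Ioi.2 (half_pos h0)) h0 (half_le_self h0.le)
  linarith

lemma exists_expect_gammaT_eq (hT : IsMarkovSemigroup T) (hs : IsSymmetricSemigroup T)
    (hd : IsDiffusion T) {c d : ℝ} (hV : VaropoulosBound T c d) (hc : 0 < c) (g : Linf μ)
    {t : ℝ} (ht : 0 < t) :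
    ∃ s > 0, expect μ (gammaT T t g g) = carreInt T (T s g) (T s g) 1 := by
  have hcont : ContinuousOn (fun s => expect μ (g * T s g)) (Set.Icc 0 t) := by
    simp only [expect_mul]
    exact (hT.ultraweak_continuous g g (linf_integrable g)).mono Set.Icc_subset_Ici_self
  obtain ⟨s, hs0, hslope⟩ := exists_hasDerivAt_eq_slope (fun s => expect μ (g * T s g))
    (fun s => -expect μ (g * genMap T s g)) ht hcont fun s hs0 => by
      simpa using! (expect μ).hasFDerivAt.comp_hasDerivAt s (hasDerivAt_linf_mul
        (hasDerivAt_const s g) (hasDerivAt_map hT hs hV hc g hs0.1))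
  refine ⟨s / 2, half_pos hs0.1, ?_⟩
  rw [← expect_mul_genMap hT hs hd hV hc g hs0.1, expect_gammaT hT hs ht.le, mul_sub, map_sub,
    neg_eq_iff_eq_neg.1 hslope, hT.zero_apply, sub_zero]
  ring

lemma tendsto_carreInt_map_self (hT : IsMarkovSemigroup T) (hs : IsSymmetricSemigroup T)
    (hd : IsDiffusion T) {c d : ℝ} (hV : VaropoulosBound T c d) (hc : 0 < c) {g : Linf μ}
    (hg : InDirichletAlgebra T g) :
    Tendsto (fun s => carreInt T (T s g) (T s g) 1) (𝓝[>] 0) (𝓝 (carreInt T g g 1)) := by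
  have hle : ∀ s > 0, carreInt T (T s g) (T s g) 1 ≤ carreInt T g g 1 := fun s h0 => by
    have hsub := carreInt_map_sub_le hT hs hd hV hc hg (mul_pos two_pos h0)
    rw [mul_div_cancel_left₀ s two_ne_zero] at hsub
    exact sub_nonneg.1 <| (carreInt_self_nonneg hT hd ((inDirichletAlgebra_map hT hs hV hc g
      (mul_pos two_pos h0)).sub hT hs hg) linf_one_nonneg).trans hsub
  refine tendsto_order.2 ⟨fun a ha => ?_, fun a ha => ?_⟩
  · obtain ⟨t, hat, ht⟩ := (((tendsto_carreInt hd hg hg 1).eventually (lt_mem_nhds ha)).and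
      self_mem_nhdsWithin).exists
    obtain ⟨r, hr, hrt⟩ := exists_expect_gammaT_eq hT hs hd hV hc g ht
    rw [one_mul, hrt] at hat
    filter_upwards [Ioo_mem_nhdsGT hr] with s hsr
    exact hat.trans_le (antitoneOn_carreInt_map hT hs hd hV hc g hsr.1 hr hsr.2.le)
  · filter_upwards [self_mem_nhdsWithin] with s h0 using (hle s h0).trans_lt ha

lemma tendsto_carreInt_map_sub (hT : IsMarkovSemigroup T) (hs : IsSymmetricSemigroup T)
    (hd : IsDiffusion T) {c d : ℝ} (hV : VaropoulosBound T c d) (hc : 0 < c) {g φ : Linf μ}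
    (hg : InDirichletAlgebra T g) (hφ : 0 ≤ φ) :
    Tendsto (fun s => carreInt T (T s g - g) (T s g - g) φ) (𝓝[>] 0) (𝓝 0) := by
  have hhalf : Tendsto (fun s : ℝ => s / 2) (𝓝[>] 0) (𝓝[>] 0) := by
    refine tendsto_nhdsWithin_iff.2 ⟨?_, ?_⟩
    · exact ((continuous_id.div_const (2 : ℝ)).tendsto' 0 0 (zero_div 2)).mono_left
        nhdsWithin_le_nhds
    · filter_upwards [self_mem_nhdsWithin] with s h0 using Set.mem_Ioi.2 (half_pos h0)
  have hbound := (((tendsto_carreInt_map_self hT hs hd hV hc hg).comp hhalf).const_sub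
    (carreInt T g g 1)).const_mul ‖φ‖
  rw [sub_self, mul_zero] at hbound
  have hDir : ∀ s > 0, InDirichletAlgebra T (T s g - g) := fun s h0 =>
    (inDirichletAlgebra_map hT hs hV hc g h0).sub hT hs hg
  refine tendsto_of_tendsto_of_tendsto_of_le_of_le' tendsto_const_nhds hbound ?_ ?_
  · filter_upwards [self_mem_nhdsWithin] with s h0 using carreInt_self_nonneg hT hd (hDir s h0) hφ
  · filter_upwards [self_mem_nhdsWithin] with s h0
    calc carreInt T (T s g - g) (T s g - g) φ
        ≤ carreInt T (T s g - g) (T s g - g) (‖φ‖ • 1) := by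
          rw [← sub_nonneg, ← map_sub]
          exact carreInt_self_nonneg hT hd (hDir s h0) (sub_nonneg.2 (linf_le_norm_smul_one φ))
      _ ≤ ‖φ‖ * (carreInt T g g 1 - carreInt T (T (s / 2) g) (T (s / 2) g) 1) := by
          rw [map_smul, smul_eq_mul]
          exact mul_le_mul_of_nonneg_left (carreInt_map_sub_le hT hs hd hV hc hg h0) (norm_nonneg φ)

lemma tendsto_carreInt_map_map (hT : IsMarkovSemigroup T) (hs : IsSymmetricSemigroup T)
    (hd : IsDiffusion T) {c d : ℝ} (hV : VaropoulosBound T c d) (hc : 0 < c) {g φ : Linf μ}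
    (hg : InDirichletAlgebra T g) (hφ : 0 ≤ φ) :
    Tendsto (fun s => carreInt T (T s g) (T s g) φ) (𝓝[>] 0) (𝓝 (carreInt T g g φ)) := by
  have hsub := tendsto_carreInt_map_sub hT hs hd hV hc hg hφ
  have hDir : ∀ᶠ s in 𝓝[>] 0, InDirichletAlgebra T (T s g - g) := by
    filter_upwards [self_mem_nhdsWithin] with s h0 using
      (inDirichletAlgebra_map hT hs hV hc g h0).sub hT hs hg
  have hcross : Tendsto (fun s => carreInt T g (T s g - g) φ) (𝓝[>] 0) (𝓝 0) := by
    have hsqrt := (hsub.const_mul (carreInt T g g φ)).sqrt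
    rw [mul_zero, Real.sqrt_zero] at hsqrt
    refine squeeze_zero_norm' ?_ hsqrt
    filter_upwards [hDir] with s hr using Real.abs_le_sqrt (sq_carreInt_le hT hs hd hg hr hφ)
  have hsum := ((hcross.const_mul 2).const_add (carreInt T g g φ)).add hsub
  rw [mul_zero, add_zero, add_zero] at hsum
  refine hsum.congr' ?_
  filter_upwards [hDir] with s hr
  simpa using (carreInt_add_smul_self hT hs hd hg hr 1 φ).symm

end Energy

section Entropy

/-- The entropy `∫ ρ log ρ` of a bounded density `ρ`. -/
def entropy (ρ : Linf μ) : ℝ :=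
  ∫ x, ρ x * Real.log (ρ x) ∂μ

lemma mul_log_sub_le {y z : ℝ} (hy : 0 < y) (hz : 0 < z) :
    y * Real.log y - z * Real.log z ≤ (Real.log y + 1) * (y - z) := by
  have hlog := mul_le_mul_of_nonneg_left (Real.log_le_sub_one_of_pos (div_pos hy hz)) hz.le
  rw [Real.log_div hy.ne' hz.ne', mul_sub, mul_sub, mul_div_cancel₀ _ hz.ne'] at hlog
  linarith

variable {ρ η g : Linf μ} {a : ℝ}

lemma exists_log (ha : 0 < a) (hρ : ∀ᵐ x ∂μ, a ≤ ρ x) :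
    ∃ g : Linf μ, ∀ᵐ x ∂μ, g x = Real.log (ρ x) := by
  refine exists_linf (C := max |Real.log a| |Real.log ‖ρ‖|)
    (Real.measurable_log.comp_aemeasurable (Lp.memLp ρ).1.aemeasurable).aestronglyMeasurable ?_
  filter_upwards [hρ, linf_ae_abs_le ρ] with x hax hxρ
  have hxρ' := (le_abs_self _).trans hxρ
  exact abs_le_max_abs_abs (Real.log_le_log ha hax) (Real.log_le_log (ha.trans_le hax) hxρ')

variable [IsFiniteMeasure μ]

lemma integrable_mul_log (ha : 0 < a) (hρ : ∀ᵐ x ∂μ, a ≤ ρ x) :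
    Integrable (fun x => ρ x * Real.log (ρ x)) μ := by
  obtain ⟨g, hg⟩ := exists_log ha hρ
  refine (linf_mul_integrable ρ (linf_integrable g)).congr ?_
  filter_upwards [hg] with x hx
  rw [hx]

lemma entropy_sub_le (ha : 0 < a) (hρ : ∀ᵐ x ∂μ, a ≤ ρ x) (hη : ∀ᵐ x ∂μ, a ≤ η x)
    (hg : ∀ᵐ x ∂μ, g x = Real.log (ρ x)) (hE : expect μ ρ = expect μ η) :
    entropy ρ - entropy η ≤ expect μ (g * (ρ - η)) := by
  have hshift : expect μ (g * (ρ - η)) = expect μ ((g + 1) * (ρ - η)) := by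
    rw [add_mul, map_add, one_mul, map_sub _ ρ, hE, sub_self, add_zero]
  have hρint := integrable_mul_log ha hρ
  have hηint := integrable_mul_log ha hη
  rw [entropy, entropy, ← integral_sub hρint hηint, hshift, expect_apply]
  refine integral_mono_ae (hρint.sub hηint) (linf_integrable _) ?_
  filter_upwards [hρ, hη, hg, coeFn_mul (g + 1) (ρ - η), Lp.coeFn_add g 1, Lp.coeFn_sub ρ η,
    coeFn_one (μ := μ)] with x hρx hηx hgx hmul hadd hsub hone
  rw [hmul, hadd, hsub, Pi.add_apply, Pi.sub_apply, hgx, hone]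
  exact mul_log_sub_le (ha.trans_le hρx) (ha.trans_le hηx)

lemma entropy_map_le {P : Linf μ →L[ℝ] Linf μ} (hP : ∀ f, 0 ≤ f → 0 ≤ P f) (hone : P 1 = 1)
    (hE : ∀ f, expect μ (P f) = expect μ f) (ha : 0 < a) (hρ : ∀ᵐ x ∂μ, a ≤ ρ x) :
    entropy (P ρ) ≤ entropy ρ := by
  obtain ⟨g, hg⟩ := exists_log ha hρ
  have hPρ := ae_le_map_of_ae_le hP hone hρ
  have htangent : ∀ᵐ x ∂μ, ∀ r : ℝ, 0 ≤ ∑ i : Fin 3, ![1, -(r + 1), Real.exp r] i *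
      P (![ρ * g, ρ, 1] i) x := by
    refine ae_forall_map_sum_nonneg (c := fun i r => ![1, -(r + 1), Real.exp r] i) hP _
      (fun i => by fin_cases i; exacts [continuous_const, by fun_prop, Real.continuous_exp])
      fun r => ?_
    filter_upwards [hρ, hg, coeFn_mul ρ g, coeFn_one (μ := μ)] with x hρx hgx hmul h1
    have hle := mul_log_sub_le (Real.exp_pos r) (ha.trans_le hρx)
    rw [Real.log_exp] at hle
    simp only [Fin.sum_univ_three, Matrix.cons_val, hmul, hgx, h1]
    linarith
  calc entropy (P ρ) ≤ expect μ (P (ρ * g)) := by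
        rw [expect_apply]
        refine integral_mono_ae (integrable_mul_log ha hPρ) (linf_integrable _) ?_
        filter_upwards [htangent, hPρ, coeFn_one (μ := μ)] with x hx hPx h1
        have hlog := hx (Real.log (P ρ x))
        simp only [Fin.sum_univ_three, Matrix.cons_val, hone, h1,
          Real.exp_log (ha.trans_le hPx)] at hlog
        linarith
    _ = entropy ρ := by
        rw [hE, expect_mul]
        exact integral_congr_ae (hg.mono fun x hx => by simp only [hx])

lemma entropy_midpoint_one_le (ha : 0 < a) (hρ : ∀ᵐ x ∂μ, a ≤ ρ x) :
    entropy ((2⁻¹ : ℝ) • (1 + ρ)) ≤ entropy ρ / 2 := by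
  have hcoe : ∀ᵐ x ∂μ, ((2⁻¹ : ℝ) • (1 + ρ) : Linf μ) x = 2⁻¹ * 1 + 2⁻¹ * ρ x := by
    filter_upwards [Lp.coeFn_smul (2⁻¹ : ℝ) (1 + ρ), Lp.coeFn_add 1 ρ, coeFn_one (μ := μ)]
      with x hsmul hadd hone
    rw [hsmul, Pi.smul_apply, hadd, Pi.add_apply, hone, smul_eq_mul, mul_add]
  have hhalf : ∀ᵐ x ∂μ, 2⁻¹ ≤ ((2⁻¹ : ℝ) • (1 + ρ) : Linf μ) x := by
    filter_upwards [hcoe, hρ] with x hx hρx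
    linarith
  rw [entropy, entropy, ← integral_div]
  refine integral_mono_ae (integrable_mul_log (by norm_num) hhalf)
    ((integrable_mul_log ha hρ).div_const 2) ?_
  filter_upwards [hcoe, hρ] with x hx hρx
  have hconv := Real.convexOn_mul_log.2 (Set.mem_Ici.2 zero_le_one)
    (Set.mem_Ici.2 (ha.le.trans hρx)) (by norm_num : (0 : ℝ) ≤ 2⁻¹) (by norm_num : (0 : ℝ) ≤ 2⁻¹)
    (by norm_num)
  simp only [smul_eq_mul, Real.log_one, mul_zero, zero_add] at hconv
  rw [hx]
  linarith

/-- The dominated constant `1/2` makes `2 P - E` positive, and `P ρ` is the midpoint of `1` and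
`(2 P - E) ρ`. -/
lemma entropy_map_le_half [IsProbabilityMeasure μ] {P : Linf μ →L[ℝ] Linf μ}
    (hP : ∀ f, 0 ≤ f → (expect μ f / 2) • 1 ≤ P f) (hone : P 1 = 1)
    (hE : ∀ f, expect μ (P f) = expect μ f) (ha : 0 < a) (hρ : ∀ᵐ x ∂μ, a ≤ ρ x)
    (hρ1 : expect μ ρ = 1) : entropy (P ρ) ≤ entropy ρ / 2 := by
  let Q : Linf μ →L[ℝ] Linf μ := (2 : ℝ) • P - (expect μ).smulRight (1 : Linf μ)
  have hQ : ∀ f, Q f = (2 : ℝ) • P f - expect μ f • (1 : Linf μ) := fun f => rfl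
  have hQ0 : ∀ f, 0 ≤ f → 0 ≤ Q f := fun f hf => by
    have hdouble : Q f = (P f - (expect μ f / 2) • 1) + (P f - (expect μ f / 2) • 1) := by
      rw [hQ]; module
    rw [hdouble]
    exact add_nonneg (sub_nonneg.2 (hP f hf)) (sub_nonneg.2 (hP f hf))
  have hQ1 : Q 1 = 1 := by rw [hQ, hone, expect_one]; module
  have hQE : ∀ f, expect μ (Q f) = expect μ f := fun f => by
    rw [hQ, map_sub, map_smul, map_smul, hE, expect_one, smul_eq_mul, smul_eq_mul]; ring
  have hmid : P ρ = (2⁻¹ : ℝ) • (1 + Q ρ) := by rw [hQ, hρ1]; module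
  rw [hmid]
  exact (entropy_midpoint_one_le ha (ae_le_map_of_ae_le hQ0 hQ1 hρ)).trans
    (div_le_div_of_nonneg_right (entropy_map_le hQ0 hQ1 hQE ha hρ) zero_le_two)

lemma abs_entropy_sub_le [IsProbabilityMeasure μ] {K : NNReal} {s : Set ℝ}
    (hK : LipschitzOnWith K (fun y => y * Real.log y) s) (ha : 0 < a)
    (haρ : ∀ᵐ x ∂μ, a ≤ ρ x) (haη : ∀ᵐ x ∂μ, a ≤ η x) (hρ : ∀ᵐ x ∂μ, ρ x ∈ s)
    (hη : ∀ᵐ x ∂μ, η x ∈ s) : |entropy ρ - entropy η| ≤ K * ‖toL2 μ (ρ - η)‖ := by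
  rw [entropy, entropy, ← integral_sub (integrable_mul_log ha haρ) (integrable_mul_log ha haη)]
  calc |∫ x, (ρ x * Real.log (ρ x) - η x * Real.log (η x)) ∂μ|
      ≤ ∫ x, K * |(ρ - η) x| ∂μ := by
        rw [← Real.norm_eq_abs]
        refine norm_integral_le_of_norm_le ((linf_integrable (ρ - η)).abs.const_mul K) ?_
        filter_upwards [hρ, hη, Lp.coeFn_sub ρ η] with x hρx hηx hsub
        rw [hsub]
        exact hK.dist_le_mul _ hρx _ hηx
    _ ≤ K * ‖toL2 μ (ρ - η)‖ := by
        rw [integral_const_mul]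
        exact mul_le_mul_of_nonneg_left (integral_abs_le_norm_toL2 _) K.coe_nonneg

end Entropy

section Fisher

variable [IsProbabilityMeasure μ] {ρ g : Linf μ} {Aρ : Ω → ℝ} {a : ℝ}

lemma InDirichletAlgebra.log (hT : IsMarkovSemigroup T) (hs : IsSymmetricSemigroup T)
    (hρ : InDirichletAlgebra T ρ) (ha : 0 < a) (haρ : ∀ᵐ x ∂μ, a ≤ ρ x)
    (hg : ∀ᵐ x ∂μ, g x = Real.log (ρ x)) : InDirichletAlgebra T g := by
  refine hρ.comp_contDiffOn hT hs (b := ‖ρ‖)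
    (Real.contDiffOn_log.mono fun y hy => (ha.trans_le hy.1).ne') ?_ hg
  filter_upwards [haρ, linf_ae_abs_le ρ] with x hax hxρ using ⟨hax, (le_abs_self _).trans hxρ⟩

/-- The chain rule for `ρ = exp g` turns `∫ w (A ρ)` into an integral against `ρ`. -/
lemma integral_mul_generator_eq_carreInt_log (hT : IsMarkovSemigroup T)
    (hs : IsSymmetricSemigroup T) (hd : IsDiffusion T) (hρ : HasGenerator T ρ Aρ) (ha : 0 < a)
    (haρ : ∀ᵐ x ∂μ, a ≤ ρ x) (hg : ∀ᵐ x ∂μ, g x = Real.log (ρ x)) {w : Linf μ}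
    (hw : InDirichletAlgebra T w) : ∫ x, w x * Aρ x ∂μ = carreInt T g w ρ := by
  have hρd := hρ.inDirichletAlgebra hT hs
  have hexp : ∀ᵐ x ∂μ, ρ x = Real.exp (g x) := by
    filter_upwards [haρ, hg] with x hax hgx
    rw [hgx, Real.exp_log (ha.trans_le hax)]
  rw [← carreInt_one_of_hasGenerator hT hs hd hw hρ, carreInt_comm hd hw hρd,
    carreInt_comp hT hs hd (hρd.log hT hs ha haρ hg) hw Real.contDiff_exp hexp
      (by simpa only [Real.deriv_exp] using hexp) linf_one_nonneg, one_mul]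

lemma HasGenerator.integral_map {w : Linf μ} {B : Ω → ℝ} (hT : IsMarkovSemigroup T)
    (hs : IsSymmetricSemigroup T) (hρ : HasGenerator T ρ Aρ) {t : ℝ} (ht : 0 ≤ t)
    (hB : HasGenerator T (T t ρ) B) : ∫ x, w x * B x ∂μ = ∫ x, T t w x * Aρ x ∂μ := by
  refine tendsto_nhds_unique (hB.tendsto_expect hT hs w)
    ((hρ.tendsto_expect hT hs (T t w)).congr' ?_)
  filter_upwards [self_mem_nhdsWithin] with s h0
  rw [← hs.expect_symm ht, map_sub, ← hT.add_apply ht (le_of_lt h0),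
    ← hT.add_apply (le_of_lt h0) ht, add_comm]

lemma HasGenerator.exists_map (hT : IsMarkovSemigroup T) (hs : IsSymmetricSemigroup T)
    (hρ : HasGenerator T ρ Aρ) {t : ℝ} (ht : 0 ≤ t) : ∃ B : Ω → ℝ, HasGenerator T (T t ρ) B := by
  have hmap := (isSymmContractionSemigroup_l2Semigroup hT hs).hasHilbertGenerator_map
    ((hasGenerator_iff_toLp hT hs hρ.1).1 hρ) ht
  rw [l2Semigroup_toL2_of_nonneg hT hs ht] at hmap
  exact ⟨_, (hasGenerator_iff hT hs).2 hmap⟩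

lemma tendsto_integral_map_mul (hT : IsMarkovSemigroup T) (f : Linf μ) {B : Ω → ℝ}
    (hB : Integrable B μ) :
    Tendsto (fun u => ∫ x, T u f x * B x ∂μ) (𝓝[>] 0) (𝓝 (∫ x, f x * B x ∂μ)) := by
  have hlim := (hT.ultraweak_continuous f B hB 0 (Set.mem_Ici.2 le_rfl)).tendsto.mono_left
    (nhdsWithin_mono 0 Set.Ioi_subset_Ici_self)
  simpa only [hT.zero_apply, mul_comm] using hlim

lemma sq_integral_map_mul_le (hT : IsMarkovSemigroup T) (hs : IsSymmetricSemigroup T)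
    (hd : IsDiffusion T) {lam : ℝ} (hCD : CurvatureDimension T lam) {c d : ℝ}
    (hV : VaropoulosBound T c d) (hc : 0 < c) (hρ : HasGenerator T ρ Aρ) (ha : 0 < a)
    (haρ : ∀ᵐ x ∂μ, a ≤ ρ x) {g₀ : Linf μ} (hg₀ : ∀ᵐ x ∂μ, g₀ x = Real.log (ρ x)) {B : Ω → ℝ}
    {t u : ℝ} (ht : 0 ≤ t) (hu : 0 < u) (hB : HasGenerator T (T t ρ) B) :
    (∫ x, T u g x * B x ∂μ) ^ 2 ≤ Real.exp (-(2 * lam * t)) * carreInt T g₀ g₀ ρ *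
      carreInt T (T u g) (T u g) (T t ρ) := by
  have hg₀d := (hρ.inDirichletAlgebra hT hs).log hT hs ha haρ hg₀
  have hTgd := inDirichletAlgebra_map hT hs hV hc g (add_pos_of_pos_of_nonneg hu ht)
  have hρ0 : 0 ≤ ρ := linf_nonneg_iff.2 (haρ.mono fun x hx => ha.le.trans hx)
  rw [hρ.integral_map hT hs ht hB, ← hT.add_apply ht hu.le, add_comm t u,
    integral_mul_generator_eq_carreInt_log hT hs hd hρ ha haρ hg₀ hTgd]
  calc carreInt T g₀ (T (u + t) g) ρ ^ 2
      ≤ carreInt T g₀ g₀ ρ * carreInt T (T (u + t) g) (T (u + t) g) ρ :=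
        sq_carreInt_le hT hs hd hg₀d hTgd hρ0
    _ ≤ carreInt T g₀ g₀ ρ *
        (Real.exp (-(2 * lam * t)) * carreInt T (T u g) (T u g) (T t ρ)) := by
        refine mul_le_mul_of_nonneg_left ?_ (carreInt_self_nonneg hT hd hg₀d hρ0)
        rw [Real.exp_neg, ← div_eq_inv_mul, le_div_iff₀' (Real.exp_pos _)]
        exact gradient_estimate hT hs hd hCD hV hc g hρ0 ht hu
    _ = _ := by ring

lemma fisher_decay (hT : IsMarkovSemigroup T) (hs : IsSymmetricSemigroup T)
    (hd : IsDiffusion T) {lam : ℝ} (hCD : CurvatureDimension T lam) {c d : ℝ}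
    (hV : VaropoulosBound T c d) (hc : 0 < c) (hρ : HasGenerator T ρ Aρ) (ha : 0 < a)
    (haρ : ∀ᵐ x ∂μ, a ≤ ρ x) {g₀ : Linf μ} (hg₀ : ∀ᵐ x ∂μ, g₀ x = Real.log (ρ x)) {B : Ω → ℝ}
    {t : ℝ} (ht : 0 ≤ t) (hB : HasGenerator T (T t ρ) B)
    (hg : ∀ᵐ x ∂μ, g x = Real.log (T t ρ x)) :
    ∫ x, g x * B x ∂μ ≤ Real.exp (-(2 * lam * t)) * ∫ x, g₀ x * Aρ x ∂μ := by
  have haTρ := ae_le_map_of_ae_le (hT.nonneg t ht) (hT.map_one ht) haρ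
  have hgd := (hB.inDirichletAlgebra hT hs).log hT hs ha haTρ hg
  have hg₀d := (hρ.inDirichletAlgebra hT hs).log hT hs ha haρ hg₀
  have hρ0 : 0 ≤ ρ := linf_nonneg_iff.2 (haρ.mono fun x hx => ha.le.trans hx)
  have hI := integral_mul_generator_eq_carreInt_log hT hs hd hρ ha haρ hg₀ hg₀d
  have hJ := integral_mul_generator_eq_carreInt_log hT hs hd hB ha haTρ hg hgd
  have hI0 := carreInt_self_nonneg hT hd hg₀d hρ0
  have hJ0 := carreInt_self_nonneg hT hd hgd (hT.nonneg t ht ρ hρ0)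
  have hsq : (∫ x, g x * B x ∂μ) ^ 2 ≤
      Real.exp (-(2 * lam * t)) * carreInt T g₀ g₀ ρ * carreInt T g g (T t ρ) := by
    refine le_of_tendsto_of_tendsto
      ((tendsto_integral_map_mul hT g (hB.1.integrable one_le_two)).pow 2)
      ((tendsto_carreInt_map_map hT hs hd hV hc hgd (hT.nonneg t ht ρ hρ0)).const_mul _) ?_
    filter_upwards [self_mem_nhdsWithin] with u hu
    exact sq_integral_map_mul_le hT hs hd hCD hV hc hρ ha haρ hg₀ ht hu hB
  rw [hJ] at hsq ⊢
  rw [hI]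
  rcases hJ0.eq_or_lt with hJ0 | hJ0
  · rw [← hJ0]; positivity
  · exact le_of_mul_le_mul_right (by rwa [← sq]) hJ0

end Fisher

section EntropyProduction

variable [IsProbabilityMeasure μ] {ρ g : Linf μ} {Aρ : Ω → ℝ} {a : ℝ}

lemma continuousOn_entropy_map (hT : IsMarkovSemigroup T) (hs : IsSymmetricSemigroup T)
    (ha : 0 < a) (haρ : ∀ᵐ x ∂μ, a ≤ ρ x) :
    ContinuousOn (fun t => entropy (T t ρ)) (Set.Ici 0) := by
  have hsmooth : ContDiffOn ℝ 1 (fun y => y * Real.log y) (Set.Icc a ‖ρ‖) :=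
    contDiffOn_id.mul (Real.contDiffOn_log.mono fun y hy => (ha.trans_le hy.1).ne')
  obtain ⟨K, hK⟩ := hsmooth.exists_lipschitzOnWith one_ne_zero (convex_Icc _ _) isCompact_Icc
  have hlower : ∀ {t}, 0 ≤ t → ∀ᵐ x ∂μ, a ≤ T t ρ x := fun ht =>
    ae_le_map_of_ae_le (hT.nonneg _ ht) (hT.map_one ht) haρ
  have hmem : ∀ {t}, 0 ≤ t → ∀ᵐ x ∂μ, T t ρ x ∈ Set.Icc a ‖ρ‖ := fun ht =>
    (hlower ht).and (map_ae_le_of_ae_le (hT.nonneg _ ht) (hT.map_one ht)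
      ((linf_ae_abs_le ρ).mono fun x hx => (le_abs_self _).trans hx))
  intro t ht
  have hlim : Tendsto (fun s => K * ‖toL2 μ (T (max s 0) ρ) - toL2 μ (T (max t 0) ρ)‖)
      (𝓝[Set.Ici 0] t) (𝓝 0) := by
    simpa using ((tendsto_iff_norm_sub_tendsto_zero.1
      ((continuous_toL2_map hT hs ρ).tendsto t)).const_mul (K : ℝ)).mono_left nhdsWithin_le_nhds
  refine tendsto_iff_dist_tendsto_zero.2
    (squeeze_zero' (Eventually.of_forall fun _ => dist_nonneg) ?_ hlim)
  filter_upwards [self_mem_nhdsWithin] with s h0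
  rw [max_eq_left (Set.mem_Ici.1 h0), max_eq_left (Set.mem_Ici.1 ht), ← map_sub]
  exact abs_entropy_sub_le hK ha (hlower h0) (hlower ht) (hmem h0) (hmem ht)

lemma eventually_entropy_sub_lt (hT : IsMarkovSemigroup T) (hs : IsSymmetricSemigroup T)
    (hρ : HasGenerator T ρ Aρ) (ha : 0 < a) (haρ : ∀ᵐ x ∂μ, a ≤ ρ x)
    (hg : ∀ᵐ x ∂μ, g x = Real.log (ρ x)) {r : ℝ} (hr : ∫ x, g x * Aρ x ∂μ < r) :
    ∀ᶠ u in 𝓝[>] (0 : ℝ), u⁻¹ * (entropy ρ - entropy (T u ρ)) < r := by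
  filter_upwards [(hρ.tendsto_expect hT hs g).eventually (gt_mem_nhds hr), self_mem_nhdsWithin]
    with u hur hu
  have hu0 : 0 ≤ u := le_of_lt hu
  refine lt_of_le_of_lt (mul_le_mul_of_nonneg_left ?_ (inv_nonneg.2 hu0)) hur
  exact entropy_sub_le ha haρ (ae_le_map_of_ae_le (hT.nonneg u hu0) (hT.map_one hu0) haρ) hg
    (expect_map hT hs hu0 ρ).symm

lemma entropy_sub_le_fisher (hT : IsMarkovSemigroup T) (hs : IsSymmetricSemigroup T)
    (hd : IsDiffusion T) {lam : ℝ} (hCD : CurvatureDimension T lam) {c d : ℝ}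
    (hV : VaropoulosBound T c d) (hc : 0 < c) (hρ : HasGenerator T ρ Aρ) (ha : 0 < a)
    (haρ : ∀ᵐ x ∂μ, a ≤ ρ x) {t : ℝ} (ht : 0 ≤ t) :
    entropy ρ - entropy (T t ρ) ≤
      (∫ s in (0 : ℝ)..t, Real.exp (-(2 * lam * s))) * ∫ x, Aρ x * Real.log (ρ x) ∂μ := by
  obtain ⟨g₀, hg₀⟩ := exists_log ha haρ
  have hfisher : ∫ x, Aρ x * Real.log (ρ x) ∂μ = ∫ x, g₀ x * Aρ x ∂μ :=
    integral_congr_ae (hg₀.mono fun x hx => by simp only [hx, mul_comm])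
  rw [hfisher]
  set I := ∫ x, g₀ x * Aρ x ∂μ
  have hderiv : ∀ s, HasDerivAt (fun s => -entropy ρ + (∫ r in (0 : ℝ)..s,
      Real.exp (-(2 * lam * r))) * I) (Real.exp (-(2 * lam * s)) * I) s := fun s =>
    ((Continuous.integral_hasStrictDerivAt (by fun_prop) 0 s).hasDerivAt.mul_const I).const_add _
  have hle := image_le_of_liminf_slope_right_le_deriv_boundary
    (f := fun s => -entropy (T s ρ)) (a := 0) (b := t)
    ((continuousOn_entropy_map hT hs ha haρ).mono Set.Icc_subset_Ici_self).neg
    (by simp [hT.zero_apply]) (fun s _ => (hderiv s).continuousAt.continuousWithinAt)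
    (fun s _ => (hderiv s).hasDerivWithinAt) (fun s hst r hr => ?_) (Set.right_mem_Icc.2 ht)
  · linarith
  · have haTρ := ae_le_map_of_ae_le (hT.nonneg s hst.1) (hT.map_one hst.1) haρ
    obtain ⟨g, hg⟩ := exists_log ha haTρ
    obtain ⟨B, hB⟩ := hρ.exists_map hT hs hst.1
    have hdecay := fisher_decay hT hs hd hCD hV hc hρ ha haρ hg₀ hst.1 hB hg
    refine Eventually.frequently ?_
    filter_upwards [(tendsto_sub_nhdsGT s).eventually (eventually_entropy_sub_lt hT hs hB ha haTρ
      hg (hdecay.trans_lt hr)), self_mem_nhdsWithin] with z hz hsz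
    rw [← hT.add_apply (sub_nonneg.2 (le_of_lt hsz)) hst.1, sub_add_cancel] at hz
    rwa [slope_def_field, div_eq_inv_mul, neg_sub_neg]

end EntropyProduction

section Mixing

lemma integral_abs_of_nonneg [IsFiniteMeasure μ] {f : Linf μ} (hf : 0 ≤ f) :
    ∫ x, |f x| ∂μ = expect μ f := by
  rw [expect_apply]
  exact integral_congr_ae ((linf_nonneg_iff.1 hf).mono fun x hx => abs_of_nonneg hx)

lemma expect_mul_le_norm_mul [IsFiniteMeasure μ] {f : Linf μ} (hf : 0 ≤ f) (g : Linf μ) :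
    expect μ (f * g) ≤ ‖g‖ * expect μ f := by
  have hle := expect_nonneg (linf_mul_nonneg hf (sub_nonneg.2 (linf_le_norm_smul_one g)))
  rwa [mul_sub, mul_smul_comm, mul_one, map_sub, map_smul, smul_eq_mul, sub_nonneg] at hle

lemma linf_nonneg_of_expect_mul_nonneg [IsFiniteMeasure μ] {f : Linf μ}
    (hf : ∀ h, 0 ≤ h → 0 ≤ expect μ (h * f)) : 0 ≤ f := by
  refine linf_nonneg_iff.2 (ae_nonneg_of_forall_setIntegral_nonneg (linf_integrable f)
    fun s hs _ => ?_)
  obtain ⟨h, hh⟩ := exists_linf (μ := μ) (u := s.indicator 1) (C := 1)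
    (measurable_one.indicator hs).aestronglyMeasurable
    (Eventually.of_forall fun x => by by_cases hx : x ∈ s <;> simp [hx])
  have h0 : 0 ≤ h := linf_nonneg_iff.2 <| hh.mono fun x hx => by
    rw [hx]; exact Set.indicator_nonneg (fun _ _ => zero_le_one) x
  rw [← integral_indicator hs]
  refine (hf h h0).trans_eq ?_
  rw [expect_mul]
  refine integral_congr_ae (hh.mono fun x hx => ?_)
  by_cases hxs : x ∈ s <;> simp [hx, hxs]

variable [IsProbabilityMeasure μ]

lemma norm_toL2_sub_expect_sq_le (f : Linf μ) :
    ‖toL2 μ (f - expect μ f • 1)‖ ^ 2 ≤ expect μ (f * f) := by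
  have hexpand : (f - expect μ f • 1) * (f - expect μ f • 1) =
      f * f - (2 * expect μ f) • f + (expect μ f ^ 2) • (1 : Linf μ) := by
    simp only [sub_mul, mul_sub, smul_mul_assoc, mul_smul_comm, one_mul, mul_one]; module
  rw [norm_toL2_sq, hexpand, map_add, map_sub, map_smul, map_smul, expect_one, smul_eq_mul,
    smul_eq_mul]
  linarith [sq_nonneg (expect μ f)]

lemma HasSpectralGap.mul_norm_le {σ : ℝ} (hσ : 0 < σ) (hgap : HasSpectralGap T σ) {f g : Linf μ}
    (h : HasGenerator T f g) (hf : expect μ f = 0) : σ * ‖toL2 μ f‖ ≤ ‖toL2 μ g‖ := by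
  have hle := ENNReal.toReal_mono (ENNReal.mul_ne_top ENNReal.ofReal_ne_top h.1.2.ne) (hgap f g h)
  simp only [← expect_apply, hf, sub_zero] at hle
  rw [ENNReal.toReal_mul, ENNReal.toReal_ofReal (inv_nonneg.2 hσ.le)] at hle
  rwa [← le_inv_mul_iff₀ hσ, Lp.norm_def, Lp.norm_def, eLpNorm_congr_ae (coeFn_toL2 f),
    eLpNorm_congr_ae (coeFn_toL2 g)]

lemma norm_toL2_map_le_exp (hT : IsMarkovSemigroup T) (hs : IsSymmetricSemigroup T) {σ : ℝ}
    (hσ : 0 < σ) (hgap : HasSpectralGap T σ) {f g : Linf μ} (h : HasGenerator T f g)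
    (hf : expect μ f = 0) {t : ℝ} (ht : 0 ≤ t) :
    ‖toL2 μ (T t f)‖ ≤ Real.exp (-(σ * t)) * ‖toL2 μ f‖ := by
  rw [← l2Semigroup_toL2_of_nonneg hT hs ht]
  refine (isSymmContractionSemigroup_l2Semigroup hT hs).norm_map_le_exp_of_gap
    ((hasGenerator_iff_toL2 hT hs).1 h) hσ (fun s h0 => ?_) ht
  rw [l2Semigroup_toL2_of_nonneg hT hs h0, l2Semigroup_toL2_of_nonneg hT hs h0]
  exact hgap.mul_norm_le hσ (h.map hT hs h0) (by rw [expect_map hT hs h0, hf])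

lemma HasGenerator.sub_smul_one (hT : IsMarkovSemigroup T) (hs : IsSymmetricSemigroup T)
    {f g : Linf μ} (h : HasGenerator T f g) (a : ℝ) : HasGenerator T (f - a • 1) g := by
  rw [hasGenerator_iff_toL2 hT hs] at h ⊢
  refine h.congr' ?_
  filter_upwards [self_mem_nhdsWithin] with t ht
  have ht0 : 0 ≤ t := le_of_lt ht
  rw [l2Semigroup_toL2_of_nonneg hT hs ht0, l2Semigroup_toL2_of_nonneg hT hs ht0, ← map_sub,
    ← map_sub, map_sub (T t), map_smul, hT.map_one ht0, sub_sub_sub_cancel_right]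

lemma norm_toL2_map_sub_expect_sq_le (hT : IsMarkovSemigroup T) (hs : IsSymmetricSemigroup T)
    {c d : ℝ} (hV : VaropoulosBound T c d) {f : Linf μ} (hf : 0 ≤ f) {t : ℝ} (ht0 : 0 < t)
    (ht1 : t < 1) :
    ‖toL2 μ (T (t / 2) f - expect μ f • 1)‖ ^ 2 ≤ c * t ^ (-(d / 2)) * expect μ f ^ 2 := by
  have ht2 : 0 ≤ t / 2 := by positivity
  have hV' := hV t ht0 ht1 f
  rw [integral_abs_of_nonneg hf] at hV'
  calc ‖toL2 μ (T (t / 2) f - expect μ f • 1)‖ ^ 2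
      ≤ expect μ (T (t / 2) f * T (t / 2) f) := by
        simpa only [expect_map hT hs ht2] using norm_toL2_sub_expect_sq_le (T (t / 2) f)
    _ = expect μ (f * T t f) := by
        rw [← hs.expect_symm ht2, ← hT.add_apply ht2 ht2, add_halves]
    _ ≤ ‖T t f‖ * expect μ f := expect_mul_le_norm_mul hf _
    _ ≤ c * t ^ (-(d / 2)) * expect μ f * expect μ f :=
        mul_le_mul_of_nonneg_right hV' (expect_nonneg hf)
    _ = c * t ^ (-(d / 2)) * expect μ f ^ 2 := by ring

lemma expect_mul_map_sub_expect (hT : IsMarkovSemigroup T) (hs : IsSymmetricSemigroup T)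
    (f h : Linf μ) {t τ : ℝ} (ht : 0 ≤ t) (hτ : 0 ≤ τ) :
    expect μ ((T (t / 2) h - expect μ h • 1) * T τ (T (t / 2) f - expect μ f • 1)) =
      expect μ (h * T (t + τ) f) - expect μ h * expect μ f := by
  have ht2 : 0 ≤ t / 2 := by positivity
  have hsplit : T (t + τ) f = T (t / 2) (T τ (T (t / 2) f)) := by
    rw [← hT.add_apply hτ ht2, ← hT.add_apply ht2 (by positivity), add_left_comm, add_halves,
      add_comm]
  rw [hsplit, hs.expect_symm ht2, map_sub (T τ), map_smul, hT.map_one hτ]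
  simp only [sub_mul, mul_sub, smul_mul_assoc, mul_smul_comm, one_mul, mul_one, map_sub, map_smul,
    expect_map hT hs hτ, expect_map hT hs ht2, expect_one, smul_eq_mul]
  ring

lemma smul_one_le_map_add (hT : IsMarkovSemigroup T) (hs : IsSymmetricSemigroup T) {c d : ℝ}
    (hV : VaropoulosBound T c d) (hc : 0 < c) {σ : ℝ} (hσ : 0 < σ) (hgap : HasSpectralGap T σ)
    {f : Linf μ} (hf : 0 ≤ f) {t τ : ℝ} (ht0 : 0 < t) (ht1 : t < 1) (hτ : 0 ≤ τ) :
    ((1 - c * t ^ (-(d / 2)) * Real.exp (-(σ * τ))) * expect μ f) • 1 ≤ T (t + τ) f := by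
  refine sub_nonneg.1 (linf_nonneg_of_expect_mul_nonneg fun h hh => ?_)
  set K := c * t ^ (-(d / 2))
  have hK : 0 ≤ K := by positivity
  have hcentered : ∀ {u : Linf μ}, 0 ≤ u →
      ‖toL2 μ (T (t / 2) u - expect μ u • 1)‖ ≤ √K * expect μ u := fun hu => by
    rw [← sq_le_sq₀ (norm_nonneg _) (by have := expect_nonneg hu; positivity), mul_pow,
      Real.sq_sqrt hK]
    exact norm_toL2_map_sub_expect_sq_le hT hs hV hu ht0 ht1
  obtain ⟨g, -, hg⟩ := exists_hasDerivAt_hasGenerator hT hs hV hc f (half_pos ht0)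
  have hdecay := norm_toL2_map_le_exp hT hs hσ hgap (hg.sub_smul_one hT hs (expect μ f))
    (by rw [map_sub, map_smul, expect_one, expect_map hT hs (half_pos ht0).le, smul_eq_mul,
      mul_one, sub_self]) hτ
  have hcov : -(K * Real.exp (-(σ * τ)) * (expect μ h * expect μ f)) ≤
      expect μ (h * T (t + τ) f) - expect μ h * expect μ f := by
    have hh0 := expect_nonneg hh
    rw [← expect_mul_map_sub_expect hT hs f h ht0.le hτ, ← inner_toL2]
    refine neg_le_of_abs_le ((abs_real_inner_le_norm _ _).trans ?_)
    calc _ ≤ √K * expect μ h * (Real.exp (-(σ * τ)) * (√K * expect μ f)) := by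
          gcongr
          · exact hcentered hh
          · exact hdecay.trans (mul_le_mul_of_nonneg_left (hcentered hf) (Real.exp_pos _).le)
      _ = √K * √K * Real.exp (-(σ * τ)) * (expect μ h * expect μ f) := by ring
      _ = K * Real.exp (-(σ * τ)) * (expect μ h * expect μ f) := by rw [Real.mul_self_sqrt hK]
  rw [mul_sub, mul_smul_comm, mul_one, map_sub, map_smul, smul_eq_mul]
  linarith

lemma VaropoulosBound.one_le {c d : ℝ} (hT : IsMarkovSemigroup T) (hV : VaropoulosBound T c d) :
    1 ≤ c := by
  have hlim : Tendsto (fun t : ℝ => c * t ^ (-(d / 2))) (𝓝[<] 1) (𝓝 c) := by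
    simpa using ((Real.continuousAt_rpow_const 1 (-(d / 2)) (Or.inl one_ne_zero)).tendsto.mono_left
      nhdsWithin_le_nhds).const_mul c
  refine ge_of_tendsto hlim ?_
  filter_upwards [Ioo_mem_nhdsLT (zero_lt_one' ℝ)] with t ht
  have hnorm : 1 ≤ ‖(1 : Linf μ)‖ := by
    simpa only [mul_one, expect_one] using expect_mul_le_norm_mul linf_one_nonneg (1 : Linf μ)
  have hV1 := hV t ht.1 ht.2 1
  rw [hT.map_one ht.1.le, integral_abs_of_nonneg linf_one_nonneg, expect_one, mul_one] at hV1
  exact hnorm.trans hV1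

end Mixing

section Constants

variable {c d σ : ℝ}

/-- The time `τ` at which the spectral gap `σ` reduces the ultracontractivity constant
`c (1/2)^{-d/2}` of `T_{1/2}` to `1/2`. -/
def mixingTime (c d σ : ℝ) : ℝ :=
  ((d + 2) / 2 * Real.log 2 + Real.log c) / σ

lemma mul_exp_mixingTime (hc : 0 < c) (hσ : 0 < σ) :
    c * (1 / 2) ^ (-(d / 2)) * Real.exp (-(σ * mixingTime c d σ)) = 1 / 2 := by
  have hexponent : Real.log c + Real.log (1 / 2) * -(d / 2) + -(σ * mixingTime c d σ) =
      -Real.log 2 := by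
    rw [mixingTime, mul_div_cancel₀ _ hσ.ne', one_div, Real.log_inv]; ring
  nth_rw 1 [← Real.exp_log hc]
  rw [Real.rpow_def_of_pos (by norm_num), ← Real.exp_add, ← Real.exp_add, hexponent, Real.exp_neg,
    Real.exp_log two_pos, one_div]

lemma integral_exp_neg_mul {a : ℝ} (ha : a ≠ 0) (t : ℝ) :
    ∫ s in (0 : ℝ)..t, Real.exp (-(a * s)) = (1 - Real.exp (-(a * t))) / a := by
  rw [intervalIntegral.integral_comp_mul_left (fun x => Real.exp (-x)) ha,
    intervalIntegral.integral_comp_neg, integral_exp, mul_zero, neg_zero, Real.exp_zero,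
    smul_eq_mul, inv_mul_eq_div]

lemma mlsiConstant_eq (hc : 0 < c) (hσ : 0 < σ) (lam : ℝ) :
    mlsiConstant c d σ lam =
      (4 * ∫ s in (0 : ℝ)..1 / 2 + mixingTime c d σ, Real.exp (-(2 * lam * s)))⁻¹ := by
  rcases eq_or_ne lam 0 with rfl | hlam
  · rw [mlsiConstant, if_pos rfl, mixingTime]
    simp only [mul_zero, zero_mul, neg_zero, Real.exp_zero, intervalIntegral.integral_const,
      smul_eq_mul, mul_one, sub_zero]
    congr 1
    field_simp
    ring
  · have hexponent : -lam + Real.log 2 * (1 - (d + 2) * lam / σ) + Real.log c * -(2 * lam / σ) =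
        Real.log 2 + -(2 * lam * (1 / 2 + mixingTime c d σ)) := by
      rw [mixingTime]; field_simp; ring
    rw [integral_exp_neg_mul (mul_ne_zero two_ne_zero hlam), mlsiConstant, if_neg hlam,
      Real.rpow_def_of_pos two_pos, Real.rpow_def_of_pos hc, ← Real.exp_add, ← Real.exp_add,
      hexponent, Real.exp_add, Real.exp_log two_pos]
    generalize Real.exp (-(2 * lam * (1 / 2 + mixingTime c d σ))) = E
    rw [← div_eq_mul_inv, ← inv_div]
    congr 1
    field_simp
    ring

end Constants

section MixingTime

variable [IsProbabilityMeasure μ] {c d σ : ℝ}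

lemma VaropoulosBound.mixingTime_nonneg (hT : IsMarkovSemigroup T) (hV : VaropoulosBound T c d)
    (hd : 0 < d) (hσ : 0 < σ) : 0 ≤ mixingTime c d σ := by
  have hlogc := Real.log_nonneg (hV.one_le hT)
  rw [mixingTime]
  positivity

lemma entropy_map_mixingTime_le (hT : IsMarkovSemigroup T) (hs : IsSymmetricSemigroup T)
    (hV : VaropoulosBound T c d) (hc : 0 < c) (hd : 0 < d) (hσ : 0 < σ)
    (hgap : HasSpectralGap T σ) {ρ : Linf μ} {a : ℝ} (ha : 0 < a) (haρ : ∀ᵐ x ∂μ, a ≤ ρ x)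
    (hρ1 : expect μ ρ = 1) :
    entropy (T (1 / 2 + mixingTime c d σ) ρ) ≤ entropy ρ / 2 := by
  have hτ := hV.mixingTime_nonneg hT hd hσ
  have ht : 0 ≤ 1 / 2 + mixingTime c d σ := by positivity
  refine entropy_map_le_half (fun f hf => ?_) (hT.map_one ht) (expect_map hT hs ht) ha haρ hρ1
  have hle := smul_one_le_map_add hT hs hV hc hσ hgap hf one_half_pos one_half_lt_one hτ
  rwa [mul_exp_mixingTime hc hσ, sub_half, one_div_mul_eq_div] at hle

end MixingTime

end DiffusionMLSI

end

theorem theorem4p1 {Ω : Type*} [MeasurableSpace Ω] (μ : MeasureTheory.Measure Ω)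
    [MeasureTheory.IsProbabilityMeasure μ]
    (T : ℝ → DiffusionMLSI.Linf μ →L[ℝ] DiffusionMLSI.Linf μ)
    (hT : DiffusionMLSI.IsMarkovSemigroup T)
    (hsymm : DiffusionMLSI.IsSymmetricSemigroup T)
    (herg : DiffusionMLSI.IsErgodicSemigroup T)
    (hdiff : DiffusionMLSI.IsDiffusion T)
    (lam : ℝ) (hCD : DiffusionMLSI.CurvatureDimension T lam)
    (c d : ℝ) (hc : 0 < c) (hd : 0 < d) (hVar : DiffusionMLSI.VaropoulosBound T c d)
    (σ : ℝ) (hσ : 0 < σ) (hgap : DiffusionMLSI.HasSpectralGap T σ) :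
    DiffusionMLSI.SatisfiesMLSI T (DiffusionMLSI.mlsiConstant c d σ lam) := by
  set t := 1 / 2 + DiffusionMLSI.mixingTime c d σ with ht
  have ht0 : 0 < t := add_pos_of_pos_of_nonneg one_half_pos (hVar.mixingTime_nonneg hT hd hσ)
  set κ := ∫ s in (0 : ℝ)..t, Real.exp (-(2 * lam * s)) with hκ
  have hκ0 : 0 < κ := intervalIntegral.intervalIntegral_pos_of_pos
    (Continuous.intervalIntegrable (by fun_prop) _ _) (fun s => Real.exp_pos _) ht0
  rw [DiffusionMLSI.mlsiConstant_eq hc hσ, ← ht, ← hκ]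
  refine ⟨by positivity, ?_⟩
  rintro ρ Aρ ⟨a, ha, haρ⟩ hρ1 hρ
  have hproduction : DiffusionMLSI.entropy ρ - DiffusionMLSI.entropy (T t ρ) ≤
      κ * ∫ x, Aρ x * Real.log (ρ x) ∂μ :=
    DiffusionMLSI.entropy_sub_le_fisher hT hsymm hdiff hCD hVar hc hρ ha haρ ht0.le
  have hmixing : DiffusionMLSI.entropy (T t ρ) ≤ DiffusionMLSI.entropy ρ / 2 :=
    DiffusionMLSI.entropy_map_mixingTime_le hT hsymm hVar hc hd hσ hgap ha haρ
      (by rw [DiffusionMLSI.expect_apply, hρ1])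
  calc 2 * (4 * κ)⁻¹ * DiffusionMLSI.entropy ρ = DiffusionMLSI.entropy ρ / 2 / κ := by
        field_simp; norm_num
    _ ≤ ∫ x, Aρ x * Real.log (ρ x) ∂μ := by rw [div_le_iff₀ hκ0]; linarith
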